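/- Let $T\colon[0,1)\to[0,1)$ be an interval exchange map with half-open intervals $(I_a)_{a\in\mathcal A}$, $\mathcal A$ finite: the $I_a$, with lengths $\lambda_a>0$, $\sum_a\lambda_a=1$, are placed in $[0,1)$ in one order and their images under $T$, which is a translation on each $I_a$, are placed in $[0,1)$ in a second order. Assume that $T$ is self-similar with factor $\alpha\in(0,1)$: the first return map $T^{(1)}$ of $T$ to $[0,\alpha)$ is $T$ up to rescaling, i.e. $T^{(1)}(\alpha t)=\alpha T(t)$ for all $t\in[0,1)$. Put $I^{(1)}_a=\alpha I_a$, and let the renormalization matrix be well defined, i.e. for every $b\in\mathcal A$ all points of $I^{(1)}_b$ have the same first return time $r_b$ to $[0,\alpha)$, and for $0\le k<r_b$ the set $T^k(I^{(1)}_b)$ is contained in one of the intervals $I_a$. Let $R=(R_{a,b})_{a,b\in\mathcal A}$ with $R_{a,b}=|\{0\le k\le r_b-1 : T^k(I^{(1)}_b)\subseteq I_a\}|$, and let $M=R^{t}$. Let $\beta\in\mathbb C$ be an eigenvalue of $M$ such that either (i) $\beta$ is Galois-conjugate over $\mathbb Q$ to $\alpha^{-1}$ (they have the same minimal polynomial over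 $\mathbb Q$), or (ii) $\beta$ is Galois-conjugate over $\mathbb Q$ to $\alpha$, and $T$ is periodic for the Rauzy–Veech renormalization algorithm on $[0,\alpha)$, i.e. some positive number of steps of Rauzy–Veech induction applied to $T$ yields an interval exchange map on $[0,\alpha)$ that, up to the names of its intervals, is $T$ rescaled by $\alpha$. Then $\beta$ has algebraic and geometric multiplicity one as an eigenvalue of $M$. If moreover $\beta$ is not real, then $\beta/|\beta|$ is not a root of unity. -/

import Mathlib

/-- Combinatorial data of an interval exchange map with intervals labelled by `A`: positive
lengths, and for every label its position (counted from `0`) before (`top`) and after (`bot`)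
the exchange. The domain is `[0, ∑ a, len a)`. -/
structure IEM (A : Type*) [Fintype A] where
  len : A → ℝ
  len_pos : ∀ a, 0 < len a
  top : A ≃ Fin (Fintype.card A)
  bot : A ≃ Fin (Fintype.card A)

namespace IEM

variable {A : Type*} [Fintype A]

/-- Left endpoint of the interval labelled `a` before the exchange. -/
noncomputable def left (D : IEM A) (a : A) : ℝ :=
  ∑ b : A, if D.top b < D.top a then D.len b else 0

/-- Left endpoint of the image of the interval labelled `a`. -/
noncomputable def leftImage (D : IEM A) (a : A) : ℝ :=
  ∑ b : A, if D.bot b < D.bot a then D.len b else 0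

/-- The interval `I_a`. -/
noncomputable def interval (D : IEM A) (a : A) : Set ℝ :=
  Set.Ico (D.left a) (D.left a + D.len a)

/-- The translation vector. -/
noncomputable def delta (D : IEM A) (a : A) : ℝ := D.leftImage a - D.left a

/-- The interval exchange map: `t ↦ t + δ_a` on `I_a` (the `I_a` are pairwise disjoint), and
the identity off the domain. -/
noncomputable def map (D : IEM A) (t : ℝ) : ℝ :=
  t + ∑ a : A, (D.interval a).indicator (fun _ => D.delta a) t

/-- `n` is the first return time of `t` to `J` under `T`. -/
def IsFirstReturnTime (T : ℝ → ℝ) (J : Set ℝ) (t : ℝ) (n : ℕ) : Prop :=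
  0 < n ∧ T^[n] t ∈ J ∧ ∀ k : ℕ, 0 < k → k < n → T^[k] t ∉ J

/-- The i.e.m. on `[0, 1)` is self-similar with factor `α`: `0 < α < 1`, and the first return map
to `[0, α)` is the rescaled map `α t ↦ α T(t)`. -/
structure IsSelfSimilar (D : IEM A) (α : ℝ) : Prop where
  sum_len : ∑ a : A, D.len a = 1
  pos : 0 < α
  lt_one : α < 1
  firstReturn : ∀ t ∈ Set.Ico (0 : ℝ) 1, ∃ n : ℕ,
    IsFirstReturnTime D.map (Set.Ico 0 α) (α * t) n ∧ D.map^[n] (α * t) = α * D.map t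

/-- The rescaled interval `I_a^{(1)} = α I_a`. -/
noncomputable def scaledInterval (D : IEM A) (α : ℝ) (a : A) : Set ℝ :=
  (fun t => α * t) '' D.interval a

/-- The scaled intervals have well-defined itineraries: all points of `α I_b` have the same first
return time `r b` to `[0, α)`, and before returning `α I_b` always stays inside a single one of
the intervals. This is what the definition of the renormalization matrix (and of the
substitution of `T`) presupposes. -/
structure HasReturnTimes (D : IEM A) (α : ℝ) (r : A → ℕ) : Prop where
  returnTime : ∀ b, ∀ t ∈ D.scaledInterval α b, IsFirstReturnTime D.map (Set.Ico 0 α) t (r b)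
  itinerary : ∀ b, ∀ k < r b, ∃ a, D.map^[k] '' D.scaledInterval α b ⊆ D.interval a

/-- The renormalization matrix `R`: `R a b` is the number of `0 ≤ k < r b` with
`T^k (α I_b) ⊆ I_a`. -/
noncomputable def renormMatrix (D : IEM A) (α : ℝ) (r : A → ℕ) : Matrix A A ℕ :=
  Matrix.of fun a b =>
    Set.ncard {k : ℕ | k < r b ∧ D.map^[k] '' D.scaledInterval α b ⊆ D.interval a}

/-- The matrix `M = Rᵗ` of the substitution, with complex entries. -/
noncomputable def substMatrix (D : IEM A) (α : ℝ) (r : A → ℕ) : Matrix A A ℂ :=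
  (D.renormMatrix α r).transpose.map (fun n : ℕ => (n : ℂ))

/-- New positions when the label `b`, which is last in the order `p`, is moved to the place
immediately after `a`. -/
def insertAfter [DecidableEq A] (p : A ≃ Fin (Fintype.card A)) (a b c : A) : ℕ :=
  if c = b then (p a : ℕ) + 1 else if p c ≤ p a then (p c : ℕ) else (p c : ℕ) + 1

/-- One step of Rauzy-Veech induction (without rescaling). Let `a` and `b` be the last labels
before and after the exchange. The longer of the two wins and is shortened by the length of the
other one, and in the order in which the winner is not last, the loser is moved to the place
immediately after the winner. The step is not defined if the two lengths agree. -/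
def RauzyVeechStep [DecidableEq A] (D D' : IEM A) : Prop :=
  ∃ a b : A, (D.top a : ℕ) + 1 = Fintype.card A ∧ (D.bot b : ℕ) + 1 = Fintype.card A ∧
    ((D.len b < D.len a ∧ D'.len = Function.update D.len a (D.len a - D.len b) ∧
        D'.top = D.top ∧ ∀ c, (D'.bot c : ℕ) = insertAfter D.bot a b c) ∨
      (D.len a < D.len b ∧ D'.len = Function.update D.len b (D.len b - D.len a) ∧
        D'.bot = D.bot ∧ ∀ c, (D'.top c : ℕ) = insertAfter D.top b a c))

/-- `T` is periodic for the Rauzy-Veech renormalization algorithm on `[0, α)`: a positive number of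
steps leads to an interval exchange on `[0, α)` which, up to the names of its intervals, is `T`
rescaled by `α`. -/
def IsRauzyVeechPeriodic [DecidableEq A] (D : IEM A) (α : ℝ) : Prop :=
  ∃ D' : IEM A, Relation.TransGen RauzyVeechStep D D' ∧ ∃ e : Equiv.Perm A, ∀ a,
    D'.len (e a) = α * D.len a ∧ D'.top (e a) = D.top a ∧ D'.bot (e a) = D.bot a

end IEM

/-! The eigenvalue `α⁻¹` is handled by Perron-Frobenius theory, the eigenvalue `α` by an invariant
bilinear form, and other eigenvalues by Galois conjugation.

Aperiodicity. If the leftmost interval is not moved, then `T` fixes a small `[0, αⁿ)`, and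
self-similarity makes `T` the identity; its only possible positive eigenvalue is `1`, which excludes
`α` and `α⁻¹`. Otherwise return times to a small `[0, αⁿ)` are at least two, so scaling a periodic
orbit down at least doubles its period. But only finitely many periods occur, since a periodic orbit
can be slid left until it meets an interval endpoint. Hence `T` is aperiodic
(`aperiodic_of_delta_ne_zero`).

The eigenvalue `α⁻¹`. An aperiodic `T` admits only finitely many disjoint nonempty invariant sets
that are locally constant from the right, as each contains a left endpoint (`exists_left_mem`). With
Poincaré recurrence this forces every orbit to enter every `[0, αⁿ)`, so the towers over `[0, αⁿ)`
fill the domain. Hence `R` is primitive, and the positive length vector is an eigenvector of `R` for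
`α⁻¹`. By a maximum principle `α⁻¹` is a simple root of the characteristic polynomial, and no other
root shares a positive power with it.

The eigenvalue `α`. Let `Ω` send lengths to translations. A Rauzy-Veech step with visit matrix `B`
satisfies `Bᵗ Ω B = Ω'`, and `B` preserves the prefix sums of vectors in the kernel of `Ω'`. For a
periodic `T` this gives `Rᵗ Ω R = Ω`, while on `ker Ω` the matrix `R` only permutes prefix sums, so
eigenvalues there are roots of unity. Away from the kernel `Ω` carries eigenvectors of `R` for `γ`
to eigenvectors of `Rᵗ` for `γ⁻¹`; both properties of `α⁻¹` therefore pass to `α`.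

Conjugates. The characteristic polynomial is rational, so simplicity passes from `x` to every
conjugate `β`. If `β / ‖β‖` were a root of unity, `β` and its complex conjugate would share a power;
an embedding sending `β` to `x` would send the conjugate to a root sharing a power with `x`, hence
to `x`, and `β` would be real. -/

namespace IEM

/-! ### Prefix sums, and the interval exchange as a measure-preserving bijection -/

variable {A : Type*} [Fintype A]

/-- Sum of `v` over the labels which precede `a` in the order `p`. -/
def prefixSum {K : Type*} [AddCommMonoid K] (p : A ≃ Fin (Fintype.card A)) (v : A → K) (a : A) : K :=
  ∑ b : A, if p b < p a then v b else 0

section PrefixSum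

variable (p : A ≃ Fin (Fintype.card A))

lemma prefixSum_first {K : Type*} [AddCommMonoid K] (v : A → K) {a : A} (ha : (p a : ℕ) = 0) :
    prefixSum p v a = 0 := by
  refine Finset.sum_eq_zero fun b _ => if_neg ?_
  rw [Fin.lt_def]; omega

lemma prefixSum_succ {K : Type*} [AddCommMonoid K] (v : A → K) {a b : A}
    (hab : (p b : ℕ) = p a + 1) : prefixSum p v b = prefixSum p v a + v a := by
  classical
  have h : v a = ∑ c, if c = a then v c else 0 := by simp
  rw [h]
  unfold prefixSum
  rw [← Finset.sum_add_distrib]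
  refine Finset.sum_congr rfl fun c _ => ?_
  have hc : c = a ↔ (p c : ℕ) = p a := by rw [Fin.val_inj, p.apply_eq_iff_eq]
  simp only [Fin.lt_def, hc]
  split_ifs <;> first | omega | simp

lemma prefixSum_last {K : Type*} [AddCommMonoid K] (v : A → K) {a : A}
    (ha : (p a : ℕ) + 1 = Fintype.card A) : prefixSum p v a + v a = ∑ b, v b := by
  classical
  have h : v a = ∑ c, if c = a then v c else 0 := by simp
  rw [h]
  unfold prefixSum
  rw [← Finset.sum_add_distrib]
  refine Finset.sum_congr rfl fun c _ => ?_
  have hc : c = a ↔ (p c : ℕ) = p a := by rw [Fin.val_inj, p.apply_eq_iff_eq]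
  have := (p c).isLt
  simp only [Fin.lt_def, hc]
  split_ifs <;> first | omega | simp

variable {v : A → ℝ}

lemma prefixSum_nonneg (hv : ∀ a, 0 < v a) (a : A) : 0 ≤ prefixSum p v a :=
  Finset.sum_nonneg fun b _ => by split_ifs <;> [exact (hv b).le; exact le_rfl]

lemma prefixSum_add_le (hv : ∀ a, 0 < v a) {a b : A} (hab : p a < p b) :
    prefixSum p v a + v a ≤ prefixSum p v b := by
  classical
  have h : v a = ∑ c, if c = a then v c else 0 := by simp
  rw [h]
  unfold prefixSum
  rw [← Finset.sum_add_distrib]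
  refine Finset.sum_le_sum fun c _ => ?_
  have hc : c = a ↔ (p c : ℕ) = p a := by rw [Fin.val_inj, p.apply_eq_iff_eq]
  have := hv c
  simp only [Fin.lt_def, hc] at hab ⊢
  split_ifs <;> first | omega | linarith

lemma prefixSum_add_le_sum (hv : ∀ a, 0 < v a) (a : A) :
    prefixSum p v a + v a ≤ ∑ b, v b := by
  classical
  have h : v a = ∑ c, if c = a then v c else 0 := by simp
  nth_rw 1 [h]
  unfold prefixSum
  rw [← Finset.sum_add_distrib]
  refine Finset.sum_le_sum fun c _ => ?_
  have hc : c = a ↔ (p c : ℕ) = p a := by rw [Fin.val_inj, p.apply_eq_iff_eq]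
  have := hv c
  simp only [Fin.lt_def, hc]
  split_ifs <;> first | omega | linarith

lemma exists_prefixSum_le_lt {t : ℝ} (h0 : 0 ≤ t) (h1 : t < ∑ b, v b) :
    ∃ a, prefixSum p v a ≤ t ∧ t < prefixSum p v a + v a := by
  have hne : Nonempty A := by
    by_contra h
    rw [not_nonempty_iff] at h
    simp at h1
    linarith
  have hcard : 0 < Fintype.card A := Fintype.card_pos
  by_contra! hcon
  have key : ∀ n (hn : n < Fintype.card A), prefixSum p v (p.symm ⟨n, hn⟩) ≤ t := by
    intro n
    induction n with
    | zero => intro hn; rw [prefixSum_first p v (by simp)]; exact h0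
    | succ n ih =>
      intro hn
      rw [prefixSum_succ p v (a := p.symm ⟨n, by omega⟩) (by simp)]
      exact hcon _ (ih (by omega))
  have := hcon _ (key (Fintype.card A - 1) (by omega))
  rw [prefixSum_last p v (by simp; omega)] at this
  linarith

end PrefixSum

/-- Length of the domain. -/
def total (D : IEM A) : ℝ := ∑ a, D.len a

/-- The inverse interval exchange map. -/
def symm (D : IEM A) : IEM A where
  len := D.len
  len_pos := D.len_pos
  top := D.bot
  bot := D.top

variable (D : IEM A)

lemma left_eq_prefixSum (a : A) : D.left a = prefixSum D.top D.len a := rfl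

lemma leftImage_eq_prefixSum (a : A) : D.leftImage a = prefixSum D.bot D.len a := rfl

lemma left_nonneg (a : A) : 0 ≤ D.left a := prefixSum_nonneg _ D.len_pos a

lemma left_add_len_le (a : A) : D.left a + D.len a ≤ D.total :=
  prefixSum_add_le_sum _ D.len_pos a

lemma leftImage_nonneg (a : A) : 0 ≤ D.leftImage a := prefixSum_nonneg _ D.len_pos a

variable {D}

lemma mem_interval {a : A} {t : ℝ} :
    t ∈ D.interval a ↔ D.left a ≤ t ∧ t < D.left a + D.len a := Iff.rfl

lemma left_mem_interval (a : A) : D.left a ∈ D.interval a :=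
  ⟨le_rfl, by linarith [D.len_pos a]⟩

lemma mem_Ico_of_mem_interval {a : A} {t : ℝ} (h : t ∈ D.interval a) :
    t ∈ Set.Ico 0 D.total :=
  ⟨(D.left_nonneg a).trans h.1, h.2.trans_le (D.left_add_len_le a)⟩

lemma exists_mem_interval {t : ℝ} (h : t ∈ Set.Ico 0 D.total) : ∃ a, t ∈ D.interval a :=
  exists_prefixSum_le_lt D.top h.1 h.2

lemma eq_of_mem_interval {a b : A} {t : ℝ} (ha : t ∈ D.interval a) (hb : t ∈ D.interval b) :
    a = b := by
  rw [mem_interval] at ha hb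
  rcases lt_trichotomy (D.top a) (D.top b) with h | h | h
  · have := prefixSum_add_le D.top D.len_pos h
    rw [← left_eq_prefixSum, ← left_eq_prefixSum] at this
    linarith
  · exact D.top.injective h
  · have := prefixSum_add_le D.top D.len_pos h
    rw [← left_eq_prefixSum, ← left_eq_prefixSum] at this
    linarith

lemma map_of_mem {a : A} {t : ℝ} (h : t ∈ D.interval a) : D.map t = t + D.delta a := by
  classical
  unfold map
  rw [Finset.sum_eq_single a]
  · rw [Set.indicator_of_mem h]
  · intro b _ hb
    exact Set.indicator_of_notMem (fun h' => hb (eq_of_mem_interval h' h)) _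
  · simp

lemma map_mem_interval_symm {a : A} {t : ℝ} (h : t ∈ D.interval a) :
    D.map t ∈ D.symm.interval a := by
  rw [map_of_mem h]
  rw [mem_interval] at h
  change D.leftImage a ≤ t + (D.leftImage a - D.left a) ∧
    t + (D.leftImage a - D.left a) < D.leftImage a + D.len a
  constructor <;> linarith

lemma map_mem {t : ℝ} (h : t ∈ Set.Ico 0 D.total) : D.map t ∈ Set.Ico 0 D.total := by
  obtain ⟨a, ha⟩ := exists_mem_interval h
  exact mem_Ico_of_mem_interval (D := D.symm) (map_mem_interval_symm ha)

lemma iterate_map_mem {t : ℝ} (h : t ∈ Set.Ico 0 D.total) (n : ℕ) :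
    D.map^[n] t ∈ Set.Ico 0 D.total := by
  induction n with
  | zero => exact h
  | succ n ih => rw [Function.iterate_succ_apply']; exact map_mem ih

lemma symm_map_map {t : ℝ} (h : t ∈ Set.Ico 0 D.total) : D.symm.map (D.map t) = t := by
  obtain ⟨a, ha⟩ := exists_mem_interval h
  rw [map_of_mem (map_mem_interval_symm ha), map_of_mem ha]
  change t + (D.leftImage a - D.left a) + (D.left a - D.leftImage a) = t
  ring

lemma map_symm_map {t : ℝ} (h : t ∈ Set.Ico 0 D.total) : D.map (D.symm.map t) = t :=
  symm_map_map (D := D.symm) h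

lemma map_injOn : Set.InjOn D.map (Set.Ico 0 D.total) := fun x hx y hy h => by
  rw [← symm_map_map hx, h, symm_map_map hy]

lemma symm_iterate_map {t : ℝ} (h : t ∈ Set.Ico 0 D.total) (n : ℕ) :
    D.symm.map^[n] (D.map^[n] t) = t := by
  induction n with
  | zero => rfl
  | succ n ih =>
    rw [Function.iterate_succ_apply, Function.iterate_succ_apply',
      symm_map_map (iterate_map_mem h n), ih]

lemma iterate_map_injOn (n : ℕ) : Set.InjOn D.map^[n] (Set.Ico 0 D.total) := fun x hx y hy h => by
  rw [← symm_iterate_map hx n, h, symm_iterate_map hy n]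

lemma symm_map_mem {t : ℝ} (h : t ∈ Set.Ico 0 D.total) : D.symm.map t ∈ Set.Ico 0 D.total :=
  map_mem (D := D.symm) h

lemma total_pos [Nonempty A] : 0 < D.total :=
  Finset.sum_pos (fun a _ => D.len_pos a) Finset.univ_nonempty

/-- The label of the interval containing `t`. -/
noncomputable def label [Nonempty A] (D : IEM A) (t : ℝ) : A :=
  Classical.epsilon fun a => t ∈ D.interval a

lemma mem_interval_label [Nonempty A] {t : ℝ} (h : t ∈ Set.Ico 0 D.total) :
    t ∈ D.interval (D.label t) :=
  Classical.epsilon_spec (exists_mem_interval h)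

lemma label_eq [Nonempty A] {a : A} {t : ℝ} (h : t ∈ D.interval a) : D.label t = a :=
  eq_of_mem_interval (mem_interval_label (mem_Ico_of_mem_interval h)) h

lemma measurableSet_interval (a : A) : MeasurableSet (D.interval a) := measurableSet_Ico

lemma measurable_map : Measurable D.map := by
  unfold map
  refine measurable_id.add (Finset.measurable_sum _ fun a _ => ?_)
  exact measurable_const.indicator (measurableSet_interval a)

open MeasureTheory in
lemma volume_restrict_Ico_eq_sum (s : Set ℝ) (hs : MeasurableSet s) :
    volume.restrict (Set.Ico 0 D.total) s = ∑ a, volume (s ∩ D.interval a) := by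
  rw [Measure.restrict_apply hs]
  have h : s ∩ Set.Ico 0 D.total = ⋃ a ∈ (Finset.univ : Finset A), s ∩ D.interval a := by
    ext t
    simp only [Set.mem_inter_iff, Finset.mem_univ, Set.iUnion_true, Set.mem_iUnion]
    exact ⟨fun ⟨h1, h2⟩ => (exists_mem_interval h2).imp fun a ha => ⟨h1, ha⟩,
      fun ⟨a, h1, h2⟩ => ⟨h1, mem_Ico_of_mem_interval h2⟩⟩
  rw [h, measure_biUnion_finset]
  · intro a _ b _ hab
    refine Set.disjoint_left.2 fun t ht ht' => hab (eq_of_mem_interval ht.2 ht'.2)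
  · exact fun a _ => hs.inter (measurableSet_interval a)

open MeasureTheory in
lemma measurePreserving_map : MeasurePreserving D.map
    (volume.restrict (Set.Ico 0 D.total)) (volume.restrict (Set.Ico 0 D.total)) := by
  refine ⟨measurable_map, ?_⟩
  ext s hs
  rw [Measure.map_apply measurable_map hs, volume_restrict_Ico_eq_sum _ (measurable_map hs)]
  have := volume_restrict_Ico_eq_sum (D := D.symm) s hs
  rw [show D.symm.total = D.total from rfl] at this
  rw [this]
  refine Finset.sum_congr rfl fun a _ => ?_
  have h : D.map ⁻¹' s ∩ D.interval a = (fun t => t + D.delta a) ⁻¹' (s ∩ D.symm.interval a) := by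
    ext t
    simp only [Set.mem_inter_iff, Set.mem_preimage]
    have hiff : t + D.delta a ∈ D.symm.interval a ↔ t ∈ D.interval a := by
      change (D.leftImage a ≤ t + (D.leftImage a - D.left a) ∧
        t + (D.leftImage a - D.left a) < D.leftImage a + D.len a) ↔ _
      rw [mem_interval]
      constructor <;> rintro ⟨h1, h2⟩ <;> constructor <;> linarith
    rw [hiff]
    constructor
    · rintro ⟨h1, h2⟩; rw [map_of_mem h2] at h1; exact ⟨h1, h2⟩
    · rintro ⟨h1, h2⟩; rw [map_of_mem h2]; exact ⟨h1, h2⟩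
  rw [h, measure_preimage_add_right]

end IEM

/-! ### First return maps and visit matrices -/

namespace IEM

variable {A : Type*} [Fintype A]

lemma IsFirstReturnTime.unique {T : ℝ → ℝ} {J : Set ℝ} {t : ℝ} {m n : ℕ}
    (hm : IsFirstReturnTime T J t m) (hn : IsFirstReturnTime T J t n) : m = n := by
  rcases lt_trichotomy m n with h | h | h
  · exact absurd hm.2.1 (hn.2.2 m hm.1 h)
  · exact h
  · exact absurd hn.2.1 (hm.2.2 n hn.1 h)

/-- `T'` is the first return map of `T` to `J`, and before returning, the points of `J` with
`ℓ'`-label `b` visit the points with `ℓ`-label `a` exactly `B a b` times. -/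
def Induces (T : ℝ → ℝ) (ℓ : ℝ → A) (J : Set ℝ) (T' : ℝ → ℝ) (ℓ' : ℝ → A)
    (B : Matrix A A ℕ) : Prop :=
  ∀ t ∈ J, ∃ n, IsFirstReturnTime T J t n ∧ T^[n] t = T' t ∧
    ∀ g : A → ℕ, ∑ k ∈ Finset.range n, g (ℓ (T^[k] t)) = ∑ a, g a * B a (ℓ' t)

section Induces

variable {T T' T'' : ℝ → ℝ} {ℓ ℓ' ℓ'' : ℝ → A} {J J' : Set ℝ} {B B' : Matrix A A ℕ}

lemma Induces.map_mem (h : Induces T ℓ J T' ℓ' B) {t : ℝ} (ht : t ∈ J) : T' t ∈ J := by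
  obtain ⟨n, hn, he, -⟩ := h t ht
  exact he ▸ hn.2.1

lemma Induces.iterate_mem (h : Induces T ℓ J T' ℓ' B) {t : ℝ} (ht : t ∈ J) (m : ℕ) :
    T'^[m] t ∈ J := by
  induction m with
  | zero => exact ht
  | succ m ih => rw [Function.iterate_succ_apply']; exact h.map_mem ih

/-- Concatenating `m` excursions from `J`. The orbit of `T` meets `J` only at iterates of `T'`, and
a lower bound `c` on return times stretches time by at least `c`. Composition uses `c = 1`; the
exclusion of periodic points uses `c = 2`. -/
lemma Induces.exists_iterate (h : Induces T ℓ J T' ℓ' B) {c : ℕ}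
    (hc : ∀ t ∈ J, ∀ n, IsFirstReturnTime T J t n → c ≤ n) {t : ℝ} (ht : t ∈ J) (m : ℕ) :
    ∃ N, c * m ≤ N ∧ (m = 0 → N = 0) ∧ T^[N] t = T'^[m] t ∧
      (∀ k < N, T^[k] t ∈ J → ∃ j < m, c * j ≤ k ∧ (0 < k → 0 < j) ∧ T^[k] t = T'^[j] t) ∧
      ∀ g : A → ℕ, ∑ k ∈ Finset.range N, g (ℓ (T^[k] t)) =
        ∑ j ∈ Finset.range m, ∑ a, g a * B a (ℓ' (T'^[j] t)) := by
  induction m with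
  | zero => exact ⟨0, by simp, fun _ => rfl, rfl, fun k hk => absurd hk (Nat.not_lt_zero k), by simp⟩
  | succ m ih =>
    obtain ⟨N, hN, h0, he, hk, hg⟩ := ih
    obtain ⟨n, hn, hne, hng⟩ := h _ (h.iterate_mem ht m)
    have hcn := hc _ (h.iterate_mem ht m) n hn
    have hadd : ∀ i, T^[N + i] t = T^[i] (T'^[m] t) := fun i => by
      rw [Nat.add_comm, Function.iterate_add_apply, he]
    refine ⟨N + n, by rw [Nat.mul_succ]; omega, by omega, ?_, ?_, ?_⟩
    · rw [hadd, hne, Function.iterate_succ_apply']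
    · intro k hkN hkJ
      rcases lt_or_ge k N with hlt | hge
      · obtain ⟨j, hj, hrest⟩ := hk k hlt hkJ
        exact ⟨j, by omega, hrest⟩
      · obtain ⟨i, rfl⟩ := Nat.exists_eq_add_of_le hge
        rw [hadd] at hkJ ⊢
        have hi : i = 0 := by
          by_contra hi
          exact hn.2.2 i (by omega) (by omega) hkJ
        subst hi
        exact ⟨m, by omega, by omega, by omega, rfl⟩
    · intro g
      rw [Finset.sum_range_add, hg, Finset.sum_range_succ, ← hng]
      simp only [hadd]

lemma Induces.one_le (t : ℝ) (_ : t ∈ J) (n : ℕ) (hn : IsFirstReturnTime T J t n) : 1 ≤ n := hn.1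

lemma Induces.exists_eq_iterate (h : Induces T ℓ J T' ℓ' B) {c : ℕ} (hc1 : 1 ≤ c)
    (hc : ∀ t ∈ J, ∀ n, IsFirstReturnTime T J t n → c ≤ n) {t : ℝ} (ht : t ∈ J) {k : ℕ}
    (hk : T^[k] t ∈ J) : ∃ j, c * j ≤ k ∧ (0 < k → 0 < j) ∧ T^[k] t = T'^[j] t := by
  obtain ⟨N, hN, -, -, hkN, -⟩ := h.exists_iterate hc ht (k + 1)
  have : k < N := by nlinarith
  obtain ⟨j, -, hj⟩ := hkN k this hk
  exact ⟨j, hj⟩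

/-- Inducing is transitive, and the visit matrices multiply. -/
lemma Induces.comp (h : Induces T ℓ J T' ℓ' B) (h' : Induces T' ℓ' J' T'' ℓ'' B')
    (hJ : J' ⊆ J) : Induces T ℓ J' T'' ℓ'' (B * B') := by
  intro t ht
  obtain ⟨m, hm, hme, hmg⟩ := h' t ht
  obtain ⟨N, hN, -, he, hk, hg⟩ := h.exists_iterate Induces.one_le (hJ ht) m
  have := hm.1
  refine ⟨N, ⟨by omega, he ▸ hm.2.1, fun k hk0 hkN hkJ => ?_⟩, he.trans hme, fun g => ?_⟩
  · obtain ⟨j, hj, -, hj0, hje⟩ := hk k hkN (hJ hkJ)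
    exact hm.2.2 j (hj0 hk0) hj (hje ▸ hkJ)
  · rw [hg, hmg fun b => ∑ a, g a * B a b]
    simp only [Matrix.mul_apply, Finset.mul_sum, Finset.sum_mul]
    rw [Finset.sum_comm]
    simp only [mul_assoc]

lemma iterate_rescale {c : ℝ} (hc : c ≠ 0) (T : ℝ → ℝ) (n : ℕ) (t : ℝ) :
    (fun t => c * T (c⁻¹ * t))^[n] t = c * T^[n] (c⁻¹ * t) := by
  induction n with
  | zero => simp [hc]
  | succ n ih =>
    rw [Function.iterate_succ_apply', ih, Function.iterate_succ_apply', inv_mul_cancel_left₀ hc]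

lemma Induces.rescale (h : Induces T ℓ J T' ℓ' B) {c : ℝ} (hc : c ≠ 0)
    (hJ : ∀ t, t ∈ J' ↔ c⁻¹ * t ∈ J) :
    Induces (fun t => c * T (c⁻¹ * t)) (fun t => ℓ (c⁻¹ * t)) J'
      (fun t => c * T' (c⁻¹ * t)) (fun t => ℓ' (c⁻¹ * t)) B := by
  intro t ht
  obtain ⟨n, hn, he, hg⟩ := h _ ((hJ t).1 ht)
  refine ⟨n, ⟨hn.1, ?_, fun k hk hkn => ?_⟩, ?_, fun g => ?_⟩
  · rw [iterate_rescale hc, hJ, inv_mul_cancel_left₀ hc]; exact hn.2.1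
  · rw [iterate_rescale hc, hJ, inv_mul_cancel_left₀ hc]; exact hn.2.2 k hk hkn
  · rw [iterate_rescale hc, he]
  · simp only [iterate_rescale hc, inv_mul_cancel_left₀ hc, hg]

end Induces

variable {D : IEM A} {α : ℝ} {r : A → ℕ}

/-- The map `t ↦ c T(t / c)`. -/
noncomputable def rescaledMap (D : IEM A) (c : ℝ) (t : ℝ) : ℝ := c * D.map (c⁻¹ * t)

/-- The label of `t / c`. -/
noncomputable def rescaledLabel [Nonempty A] (D : IEM A) (c : ℝ) (t : ℝ) : A := D.label (c⁻¹ * t)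

lemma iterate_rescaledMap {c : ℝ} (hc : c ≠ 0) (n : ℕ) (t : ℝ) :
    (D.rescaledMap c)^[n] (c * t) = c * D.map^[n] t := by
  have := iterate_rescale hc D.map n (c * t)
  rwa [inv_mul_cancel_left₀ hc] at this

lemma mem_Ico_iff_inv_mul_mem {c x : ℝ} (hc : 0 < c) (t : ℝ) :
    t ∈ Set.Ico 0 (c * x) ↔ c⁻¹ * t ∈ Set.Ico 0 x := by
  rw [Set.mem_Ico, Set.mem_Ico, inv_mul_lt_iff₀ hc]
  refine and_congr_left fun _ => ⟨fun h => by positivity, fun h => ?_⟩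
  have := mul_nonneg hc.le h
  rwa [mul_inv_cancel_left₀ hc.ne'] at this

lemma IsSelfSimilar.total_eq (hD : D.IsSelfSimilar α) : D.total = 1 := hD.sum_len

lemma IsSelfSimilar.nonempty (hD : D.IsSelfSimilar α) : Nonempty A := by
  by_contra h
  rw [not_nonempty_iff] at h
  have := hD.sum_len
  simp at this

open scoped Classical in
lemma renormMatrix_eq_card [Nonempty A] (hr : D.HasReturnTimes α r)
    {b : A} {t : ℝ} (ht : t ∈ D.scaledInterval α b) (a : A) :
    D.renormMatrix α r a b = (Finset.filter (fun k => D.label (D.map^[k] t) = a)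
      (Finset.range (r b))).card := by
  rw [renormMatrix, Matrix.of_apply, ← Set.ncard_coe_finset]
  congr 1
  ext k
  simp only [Set.mem_ofPred_eq, Finset.coe_filter, Finset.mem_range]
  refine and_congr_right fun hk => ⟨fun h => label_eq (h (Set.mem_image_of_mem _ ht)), fun h => ?_⟩
  obtain ⟨c, hc⟩ := hr.itinerary b k hk
  have : D.label (D.map^[k] t) = c := label_eq (hc (Set.mem_image_of_mem _ ht))
  rw [← h, this]
  exact hc

open scoped Classical in
lemma induces_rescaledMap [Nonempty A] (hD : D.IsSelfSimilar α) (hr : D.HasReturnTimes α r) :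
    Induces D.map D.label (Set.Ico 0 α) (D.rescaledMap α) (D.rescaledLabel α)
      (D.renormMatrix α r) := by
  intro t ht
  have hα := hD.pos
  have hs : α⁻¹ * t ∈ Set.Ico (0 : ℝ) 1 := (mem_Ico_iff_inv_mul_mem hα t).1 (by rwa [mul_one])
  have hts : α * (α⁻¹ * t) = t := mul_inv_cancel_left₀ hα.ne' t
  have hmem : t ∈ D.scaledInterval α (D.rescaledLabel α t) :=
    ⟨α⁻¹ * t, mem_interval_label (by rwa [hD.total_eq]), hts⟩
  obtain ⟨n, hn, he⟩ := hD.firstReturn _ hs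
  rw [hts] at hn he
  have hnr := hn.unique (hr.returnTime _ t hmem)
  refine ⟨n, hn, he, fun g => ?_⟩
  have : ∀ a, D.renormMatrix α r a (D.rescaledLabel α t) =
      (Finset.filter (fun k => D.label (D.map^[k] t) = a) (Finset.range n)).card := fun a => by
    rw [hnr]; exact renormMatrix_eq_card hr hmem a
  simp only [this, Finset.card_filter, Finset.mul_sum]
  rw [Finset.sum_comm]
  simp

lemma induces_self [Nonempty A] [DecidableEq A] :
    Induces D.map D.label (Set.Ico 0 D.total) D.map D.label 1 := by
  intro t ht
  refine ⟨1, ⟨one_pos, map_mem ht, by omega⟩, rfl, fun g => ?_⟩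
  simp [Matrix.one_apply]

/-- The level-one relation, rescaled by `α ^ n`, is composed with the relation at level `n`; visit
matrices multiply. -/
lemma induces_rescaledMap_pow [Nonempty A] [DecidableEq A] (hD : D.IsSelfSimilar α)
    (hr : D.HasReturnTimes α r) (n : ℕ) :
    Induces D.map D.label (Set.Ico 0 (α ^ n)) (D.rescaledMap (α ^ n)) (D.rescaledLabel (α ^ n))
      (D.renormMatrix α r ^ n) := by
  induction n with
  | zero =>
    have h1 : D.rescaledMap (α ^ 0) = D.map := by ext t; simp [rescaledMap]
    have h2 : D.rescaledLabel (α ^ 0) = D.label := by ext t; simp [rescaledLabel]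
    rw [h1, h2, pow_zero, pow_zero, ← hD.total_eq]
    exact induces_self
  | succ n ih =>
    have hα := hD.pos
    have hpos : 0 < α ^ n := pow_pos hα n
    have h := (induces_rescaledMap hD hr).rescale hpos.ne' (J' := Set.Ico 0 (α ^ (n + 1)))
      (fun t => by rw [pow_succ, mem_Ico_iff_inv_mul_mem hpos])
    have h1 : (fun t => α ^ n * D.rescaledMap α ((α ^ n)⁻¹ * t)) = D.rescaledMap (α ^ (n + 1)) := by
      ext t; simp [rescaledMap, pow_succ, mul_assoc]
    have h2 : (fun t => D.rescaledLabel α ((α ^ n)⁻¹ * t)) = D.rescaledLabel (α ^ (n + 1)) := by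
      ext t; simp [rescaledLabel, pow_succ, mul_assoc]
    rw [h1, h2] at h
    rw [pow_succ (D.renormMatrix α r)]
    exact ih.comp h (Set.Ico_subset_Ico_right (pow_le_pow_of_le_one hα.le hD.lt_one.le n.le_succ))

end IEM

/-! ### Sliding orbits to the left, and aperiodic maps -/

namespace IEM

variable {A : Type*} [Fintype A] {D : IEM A}

lemma left_le_left {a b : A} {t : ℝ} (ha : D.left a ≤ t) (hb : t ∈ D.interval b) :
    D.left a ≤ D.left b := by
  rw [mem_interval] at hb
  rcases lt_trichotomy (D.top a) (D.top b) with h | h | h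
  · have := prefixSum_add_le D.top D.len_pos h
    rw [← left_eq_prefixSum, ← left_eq_prefixSum] at this
    linarith [D.len_pos a]
  · rw [D.top.injective h]
  · have := prefixSum_add_le D.top D.len_pos h
    rw [← left_eq_prefixSum, ← left_eq_prefixSum] at this
    linarith

/-- The sliding principle: a shift to the left that crosses no left endpoint stays in the same
interval, hence commutes with the map. -/
lemma map_sub_eq {x s : ℝ} (hx : x ∈ Set.Ico 0 D.total) (hs : 0 ≤ s)
    (h : ∀ a, D.left a ≤ x → D.left a ≤ x - s) : D.map (x - s) = D.map x - s := by
  obtain ⟨a, ha⟩ := exists_mem_interval hx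
  have hb : x - s ∈ D.interval a := ⟨h a ha.1, by linarith [ha.2]⟩
  rw [map_of_mem ha, map_of_mem hb]
  ring

lemma iterate_map_sub_eq {x s : ℝ} (hx : x ∈ Set.Ico 0 D.total) (hs : 0 ≤ s) {n : ℕ}
    (h : ∀ k < n, ∀ a, D.left a ≤ D.map^[k] x → D.left a ≤ D.map^[k] x - s) :
    ∀ k ≤ n, D.map^[k] (x - s) = D.map^[k] x - s := by
  intro k
  induction k with
  | zero => intro _; rfl
  | succ k ih =>
    intro hk
    rw [Function.iterate_succ_apply', ih (by omega), Function.iterate_succ_apply',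
      map_sub_eq (iterate_map_mem hx k) hs (h k (by omega))]

/-- Membership in `E` is locally constant from the right on the domain. -/
def RightConst (D : IEM A) (E : Set ℝ) : Prop :=
  ∀ x ∈ Set.Ico 0 D.total, ∃ e > 0, ∀ s, 0 ≤ s → s < e → (x + s ∈ E ↔ x ∈ E)

lemma RightConst.diff {E F : Set ℝ} (hE : D.RightConst E) (hF : D.RightConst F) :
    D.RightConst (E \ F) := by
  intro x hx
  obtain ⟨e, he, h1⟩ := hE x hx
  obtain ⟨f, hf, h2⟩ := hF x hx
  refine ⟨min e f, lt_min he hf, fun s hs hsf => ?_⟩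
  rw [Set.mem_sdiff, Set.mem_sdiff, h1 s hs (hsf.trans_le (min_le_left _ _)),
    h2 s hs (hsf.trans_le (min_le_right _ _))]

lemma rightConst_Ico (c d : ℝ) : D.RightConst (Set.Ico c d) := by
  intro x _
  rcases lt_or_ge x c with h | h
  · refine ⟨c - x, by linarith, fun s _ hs => iff_of_false ?_ ?_⟩
    · intro h'; linarith [h'.1]
    · intro h'; linarith [h'.1]
  · rcases lt_or_ge x d with h' | h'
    · exact ⟨d - x, by linarith, fun s _ hs => iff_of_true ⟨by linarith, by linarith⟩ ⟨h, h'⟩⟩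
    · exact ⟨1, one_pos, fun s hs _ => iff_of_false (fun h2 => by linarith [h2.2])
        (fun h2 => by linarith [h2.2])⟩

lemma exists_iterate_map_add_eq {E : Set ℝ} (hE : D.RightConst E) (n : ℕ) :
    ∀ x ∈ Set.Ico 0 D.total, ∃ e > 0, ∀ s, 0 ≤ s → s < e → ∀ k ≤ n,
      D.map^[k] (x + s) = D.map^[k] x + s ∧ D.map^[k] x + s ∈ Set.Ico 0 D.total ∧
        (D.map^[k] x + s ∈ E ↔ D.map^[k] x ∈ E) := by
  induction n with
  | zero =>
    intro x hx
    obtain ⟨e, he, h⟩ := hE x hx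
    refine ⟨min e (D.total - x), lt_min he (by linarith [hx.2]), fun s hs hse k hk => ?_⟩
    obtain rfl : k = 0 := by omega
    have h1 := lt_min_iff.1 hse
    exact ⟨rfl, ⟨add_nonneg hx.1 hs, by simp; linarith⟩, h s hs h1.1⟩
  | succ n ih =>
    intro x hx
    obtain ⟨a, ha⟩ := exists_mem_interval hx
    obtain ⟨e, he, h⟩ := hE x hx
    obtain ⟨f, hf, h'⟩ := ih _ (map_mem hx)
    refine ⟨min (min e f) (D.left a + D.len a - x),
      lt_min (lt_min he hf) (by linarith [ha.2]), fun s hs hse k hk => ?_⟩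
    obtain ⟨h1, h3⟩ := lt_min_iff.1 hse
    obtain ⟨h1, h2⟩ := lt_min_iff.1 h1
    have hxs : x + s ∈ D.interval a := ⟨by linarith [ha.1], by linarith⟩
    cases k with
    | zero => exact ⟨rfl, mem_Ico_of_mem_interval hxs, h s hs h1⟩
    | succ k =>
      have hT : D.map (x + s) = D.map x + s := by rw [map_of_mem hxs, map_of_mem ha]; ring
      rw [Function.iterate_succ_apply, hT, Function.iterate_succ_apply]
      exact h' s hs h2 k (by omega)

section Periodic

open Function

/-- The whole orbit is slid left by its least distance to the left endpoint below a point of it. The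
period does not change, and the slid orbit contains a left endpoint. Thus only finitely many periods
occur. -/
lemma exists_minimalPeriod_eq [Nonempty A] {x : ℝ} (hx : x ∈ Set.Ico 0 D.total)
    (hp : x ∈ periodicPts D.map) :
    ∃ a, minimalPeriod D.map x = minimalPeriod D.map (D.left a) := by
  have hpos := minimalPeriod_pos_of_mem_periodicPts hp
  set p := minimalPeriod D.map x with hpdef
  obtain ⟨k₀, hk₀, hmin⟩ := Finset.exists_min_image (Finset.range p)
    (fun k => D.map^[k] x - D.left (D.label (D.map^[k] x))) ⟨0, by simpa using hpos⟩
  set s := D.map^[k₀] x - D.left (D.label (D.map^[k₀] x)) with hs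
  have hmem := fun k => mem_interval_label (iterate_map_mem hx k)
  have hs0 : 0 ≤ s := sub_nonneg.2 (hmem k₀).1
  have hall : ∀ k a, D.left a ≤ D.map^[k] x → D.left a ≤ D.map^[k] x - s := by
    intro k a ha
    have hmod : D.map^[k % p] x = D.map^[k] x := iterate_mod_minimalPeriod_eq
    rw [← hmod] at ha ⊢
    have := hmin (k % p) (Finset.mem_range.2 (Nat.mod_lt _ hpos))
    have := left_le_left ha (hmem (k % p))
    linarith
  have hsub : ∀ k, D.map^[k] (x - s) = D.map^[k] x - s := fun k =>
    iterate_map_sub_eq hx hs0 (fun k _ => hall k) k le_rfl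
  have hiff : ∀ m, IsPeriodicPt D.map m (x - s) ↔ IsPeriodicPt D.map m x := fun m => by
    unfold IsPeriodicPt IsFixedPt
    rw [hsub]
    constructor <;> intro h <;> linarith
  have heq : minimalPeriod D.map (x - s) = p := by
    apply Nat.dvd_antisymm
    · rw [← isPeriodicPt_iff_minimalPeriod_dvd, hiff]; exact isPeriodicPt_minimalPeriod _ _
    · rw [hpdef, ← isPeriodicPt_iff_minimalPeriod_dvd, ← hiff]; exact isPeriodicPt_minimalPeriod _ _
  have hper : x - s ∈ periodicPts D.map := minimalPeriod_pos_iff_mem_periodicPts.1 (heq ▸ hpos)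
  refine ⟨D.label (D.map^[k₀] x), ?_⟩
  rw [← heq, ← minimalPeriod_apply_iterate hper k₀, hsub k₀, hs, sub_sub_cancel]

end Periodic

/-- The map has no periodic points. -/
def Aperiodic (D : IEM A) : Prop :=
  ∀ x ∈ Set.Ico 0 D.total, ∀ p : ℕ, 0 < p → D.map^[p] x ≠ x

/-- If the orbit kept distance `ε` to the right of all left endpoints, it could be slid by up to `ε`
at all times. By pigeonhole two of its points differ by some `s` with `|s| < ε`. Sliding preserves
this difference, so the orbit contains an arithmetic progression with step `s`; boundedness forces
`s = 0`, a periodic point. -/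
lemma exists_iterate_near_left [Nonempty A] (hap : D.Aperiodic) {x : ℝ}
    (hx : x ∈ Set.Ico 0 D.total) {ε : ℝ} (hε : 0 < ε) :
    ∃ k a, D.left a ≤ D.map^[k] x ∧ D.map^[k] x < D.left a + ε := by
  by_contra! hcon
  have hslide : ∀ i σ, 0 ≤ σ → σ ≤ ε → ∀ k,
      D.map^[k] (D.map^[i] x - σ) = D.map^[k] (D.map^[i] x) - σ := by
    intro i σ hσ hσε k
    refine iterate_map_sub_eq (iterate_map_mem hx i) hσ (n := k) (fun m _ a ha => ?_) k le_rfl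
    rw [← Function.iterate_add_apply] at ha ⊢
    linarith [hcon (m + i) a ha]
  have hbd : ∀ k, ⌊D.map^[k] x / ε⌋₊ < ⌊D.total / ε⌋₊ + 1 := fun k =>
    Nat.lt_succ_of_le (Nat.floor_mono (by gcongr; exact (iterate_map_mem hx k).2.le))
  obtain ⟨i, j, hij, hfl⟩ := Finite.exists_ne_map_eq_of_infinite
    (fun k => (⟨⌊D.map^[k] x / ε⌋₊, hbd k⟩ : Fin (⌊D.total / ε⌋₊ + 1)))
  wlog hlt : i < j generalizing i j
  · exact this j i hij.symm hfl.symm (by omega)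
  have hfl' : ⌊D.map^[i] x / ε⌋₊ = ⌊D.map^[j] x / ε⌋₊ := congrArg Fin.val hfl
  have hclose : |D.map^[j] x - D.map^[i] x| < ε := by
    have h1 := Nat.floor_le (div_nonneg (iterate_map_mem hx i).1 hε.le)
    have h2 := Nat.lt_floor_add_one (D.map^[i] x / ε)
    have h3 := Nat.floor_le (div_nonneg (iterate_map_mem hx j).1 hε.le)
    have h4 := Nat.lt_floor_add_one (D.map^[j] x / ε)
    rw [hfl'] at h1 h2
    have h5 : |D.map^[j] x / ε - D.map^[i] x / ε| < 1 := by
      rw [abs_lt]; constructor <;> linarith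
    rwa [← sub_div, abs_div, abs_of_pos hε, div_lt_one hε] at h5
  obtain ⟨q, hq⟩ := Nat.exists_eq_add_of_lt hlt
  set y := D.map^[i] x with hy
  have hjq : D.map^[j] x = D.map^[q + 1] y := by
    rw [hy, ← Function.iterate_add_apply, hq]; congr 1; omega
  have hym : y ∈ Set.Ico 0 D.total := iterate_map_mem hx i
  set s := D.map^[j] x - y with hs
  have hshift : ∀ k, D.map^[k] (D.map^[q + 1] y) = D.map^[k] y + s := by
    intro k
    rw [abs_lt] at hclose
    rcases le_total s 0 with h | h
    · have := hslide i (-s) (by linarith) (by linarith) k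
      rw [← hy] at this
      rw [← hjq, show D.map^[j] x = y - -s by rw [hs]; ring, this]
      ring
    · have := hslide j s h hclose.2.le k
      rw [show D.map^[j] x - s = y by rw [hs]; ring] at this
      rw [← hjq, this]
      ring
  have hm : ∀ m : ℕ, D.map^[(q + 1) * m] y = y + m * s := by
    intro m
    induction m with
    | zero => simp
    | succ m ih =>
      rw [Nat.mul_succ, Function.iterate_add_apply, hshift, ih]
      push_cast
      ring
  have hs0 : s ≠ 0 := fun h0 => by
    have := hm 1
    rw [mul_one, h0] at this
    exact hap y hym (q + 1) (Nat.succ_pos q) (by linarith)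
  obtain ⟨m, hmm⟩ := exists_nat_gt (D.total / |s|)
  rw [div_lt_iff₀ (abs_pos.2 hs0)] at hmm
  have h1 := iterate_map_mem hym ((q + 1) * m)
  rw [hm] at h1
  have h2 : |(m : ℝ) * s| < D.total := by
    rw [abs_lt]; constructor <;> linarith [h1.1, h1.2, hym.1, hym.2]
  rw [abs_mul, Nat.abs_cast] at h2
  linarith

/-- Some point of the orbit comes so close to a left endpoint, from the right, that right constancy
transfers membership to the endpoint. Consequently disjoint nonempty invariant sets of this kind are
at most as many as the labels. -/
lemma exists_left_mem [Nonempty A] (hap : D.Aperiodic) {E : Set ℝ} (hE : D.RightConst E)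
    (hinv : ∀ x ∈ Set.Ico 0 D.total, x ∈ E → D.map x ∈ E) {x : ℝ}
    (hx : x ∈ Set.Ico 0 D.total) (hxE : x ∈ E) : ∃ a, D.left a ∈ E := by
  choose e he h using fun a => hE (D.left a) (mem_Ico_of_mem_interval (left_mem_interval a))
  obtain ⟨a₀, -, hmin⟩ := Finset.exists_min_image Finset.univ e Finset.univ_nonempty
  obtain ⟨k, a, h1, h2⟩ := exists_iterate_near_left hap hx (he a₀)
  have hk : ∀ k, D.map^[k] x ∈ E := by
    intro k
    induction k with
    | zero => exact hxE
    | succ k ih => rw [Function.iterate_succ_apply']; exact hinv _ (iterate_map_mem hx k) ih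
  have h3 := h a (D.map^[k] x - D.left a) (by linarith) (by linarith [hmin a (Finset.mem_univ a)])
  rw [add_sub_cancel] at h3
  exact ⟨a, h3.1 (hk k)⟩

end IEM

/-! ### Bounded return and hitting times -/

namespace IEM

variable {A : Type*} [Fintype A] {D : IEM A}

/-- An excursion is slid left until one of its points meets the finite set of left endpoints
together with `c` and `d`. By injectivity of the map, the point met almost determines the excursion.
-/
lemma finite_firstReturnTimes [Nonempty A] {c d : ℝ} (hJ : Set.Ico c d ⊆ Set.Ico 0 D.total) :
    {n | ∃ y ∈ Set.Ico c d, IsFirstReturnTime D.map (Set.Ico c d) y n}.Finite := by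
  classical
  set J := Set.Ico c d with hJdef
  set P : Finset ℝ := Finset.univ.image D.left ∪ {c, d} with hP
  -- The Boolean records whether the marked point is met at the return time: the end of one
  -- excursion may be the start of another, and this is the only ambiguity.
  have key : ∀ n, (∃ y ∈ J, IsFirstReturnTime D.map J y n) → ∃ z : P × Bool, ∃ y ∈ J,
      IsFirstReturnTime D.map J y n ∧ ∃ k ≤ n, D.map^[k] y = z.1 ∧ (z.2 = true ↔ k = n) := by
    rintro n ⟨y, hy, hn⟩
    have hyX := hJ hy
    obtain ⟨⟨k₀, p₀⟩, hk₀, hmin⟩ := Finset.exists_min_image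
      ((Finset.range (n + 1) ×ˢ P).filter fun z => z.2 ≤ D.map^[z.1] y)
      (fun z => D.map^[z.1] y - z.2)
      ⟨(0, D.left (D.label y)), by
        simp only [Finset.mem_filter, Finset.mem_product, Finset.mem_range, hP]
        exact ⟨⟨by omega, by simp⟩, (mem_interval_label hyX).1⟩⟩
    simp only [Finset.mem_filter, Finset.mem_product, Finset.mem_range] at hk₀ hmin
    obtain ⟨⟨hk₀n, hp₀⟩, hle⟩ := hk₀
    set s := D.map^[k₀] y - p₀ with hs
    have hs0 : 0 ≤ s := sub_nonneg.2 hle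
    have hgap : ∀ k ≤ n, ∀ p ∈ P, p ≤ D.map^[k] y → p ≤ D.map^[k] y - s := by
      intro k hk p hp hpk
      have := hmin (k, p) ⟨⟨by omega, hp⟩, hpk⟩
      dsimp only at this
      linarith
    have hsub := iterate_map_sub_eq hyX hs0 (n := n)
      (fun k hk a => hgap k hk.le _ (by simp [hP]))
    have hiff : ∀ k ≤ n, (D.map^[k] (y - s) ∈ J ↔ D.map^[k] y ∈ J) := by
      intro k hk
      rw [hsub k hk, hJdef, Set.mem_Ico, Set.mem_Ico]
      have h1 := hgap k hk c (by simp [hP])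
      have h2 := hgap k hk d (by simp [hP])
      constructor
      · rintro ⟨h3, h4⟩
        exact ⟨by linarith, by by_contra! h; linarith [h2 h]⟩
      · rintro ⟨h3, h4⟩
        exact ⟨h1 h3, by linarith⟩
    refine ⟨(⟨p₀, hp₀⟩, decide (k₀ = n)), y - s, (hiff 0 (Nat.zero_le n)).2 hy,
      ⟨hn.1, (hiff n le_rfl).2 hn.2.1, fun k hk hkn => ?_⟩, k₀, by omega, ?_, by simp⟩
    · rw [hiff k hkn.le]; exact hn.2.2 k hk hkn
    · rw [hsub k₀ (by omega), hs, sub_sub_cancel]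
  choose f hf using fun n : {n | ∃ y ∈ J, IsFirstReturnTime D.map J y n} => key n.1 n.2
  have hinj : Function.Injective f := by
    intro n₁ n₂ h
    have aux : ∀ m₁ m₂ k₁ k₂ : ℕ, ∀ y₁ ∈ J, ∀ y₂ ∈ J, IsFirstReturnTime D.map J y₁ m₁ →
        IsFirstReturnTime D.map J y₂ m₂ → k₁ ≤ k₂ → (k₁ = m₁ ↔ k₂ = m₂) → k₂ ≤ m₂ →
        D.map^[k₁] y₁ = D.map^[k₂] y₂ → m₁ = m₂ := by
      intro m₁ m₂ k₁ k₂ y₁ hy₁ y₂ hy₂ hm₁ hm₂ hk hiff hk₂ heq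
      obtain ⟨i, rfl⟩ := Nat.exists_eq_add_of_le hk
      rw [Function.iterate_add_apply] at heq
      have hy := iterate_map_injOn k₁ (hJ hy₁) (iterate_map_mem (hJ hy₂) i) heq
      have hi : i = 0 ∨ i = m₂ := by
        by_contra! hi
        exact hm₂.2.2 i (by omega) (by omega) (hy ▸ hy₁)
      rcases hi with rfl | rfl
      · exact hm₁.unique (by simpa [hy] using hm₂)
      · have := hm₁.1
        omega
    obtain ⟨y₁, hy₁, hm₁, k₁, hk₁, he₁, hb₁⟩ := hf n₁
    obtain ⟨y₂, hy₂, hm₂, k₂, hk₂, he₂, hb₂⟩ := hf n₂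
    rw [h] at he₁ hb₁
    have hiff : k₁ = n₁ ↔ k₂ = n₂ := hb₁.symm.trans hb₂
    apply Subtype.ext
    rcases le_total k₁ k₂ with hle | hle
    · exact aux _ _ _ _ y₁ hy₁ y₂ hy₂ hm₁ hm₂ hle hiff hk₂ (he₁.trans he₂.symm)
    · exact (aux _ _ _ _ y₂ hy₂ y₁ hy₁ hm₂ hm₁ hle hiff.symm hk₁ (he₂.trans he₁.symm)).symm
  exact Set.finite_coe_iff.1 (Finite.of_injective f hinj)

/-- By Poincaré recurrence, every point of a half-open interval returns to it, within a bounded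
time. -/
lemma exists_return_bound [Nonempty A] {c d : ℝ} (hJ : Set.Ico c d ⊆ Set.Ico 0 D.total) :
    ∃ N, ∀ y ∈ Set.Ico c d, ∃ n, 0 < n ∧ n ≤ N ∧ D.map^[n] y ∈ Set.Ico c d := by
  classical
  obtain ⟨N, hN⟩ := (finite_firstReturnTimes hJ).bddAbove
  have hbound : ∀ y ∈ Set.Ico c d, (∃ n, 0 < n ∧ D.map^[n] y ∈ Set.Ico c d) →
      ∃ n, 0 < n ∧ n ≤ N ∧ D.map^[n] y ∈ Set.Ico c d := by
    intro y hy hex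
    have hs := Nat.find_spec hex
    exact ⟨Nat.find hex, hs.1, hN ⟨y, hy, hs.1, hs.2, fun k hk hkn hkJ =>
      Nat.find_min hex hkn ⟨hk, hkJ⟩⟩, hs.2⟩
  refine ⟨N, fun y hy => hbound y hy ?_⟩
  by_contra! hcon
  -- Points just right of `y` follow its itinerary through time `N`, so they do not return by then,
  -- and by `hbound` never. They form a set of positive measure, against Poincaré recurrence.
  obtain ⟨e, he, h⟩ := exists_iterate_map_add_eq (rightConst_Ico c d) N y (hJ hy)
  have hW : ∀ x ∈ Set.Ico y (y + e), x ∈ Set.Ico c d ∧ x ∈ Set.Ico 0 D.total ∧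
      ∀ n, 0 < n → D.map^[n] x ∉ Set.Ico c d := by
    intro x hx
    have h' := h (x - y) (by linarith [hx.1]) (by linarith [hx.2])
    rw [add_sub_cancel] at h'
    have h0 := h' 0 (Nat.zero_le N)
    simp only [Function.iterate_zero, id, add_sub_cancel] at h0
    have hxJ := h0.2.2.2 hy
    refine ⟨hxJ, h0.2.1, fun n hn hnJ => ?_⟩
    obtain ⟨m, hm0, hmN, hm⟩ := hbound x hxJ ⟨n, hn, hnJ⟩
    obtain ⟨h1, -, h2⟩ := h' m hmN
    rw [h1, h2] at hm
    exact hcon m hm0 hm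
  have hmeas : (MeasureTheory.volume.restrict (Set.Ico 0 D.total)) (Set.Ico y (y + e)) ≠ 0 := by
    rw [MeasureTheory.Measure.restrict_apply measurableSet_Ico,
      Set.inter_eq_left.2 fun x hx => (hW x hx).2.1, Real.volume_Ico]
    simpa using he
  have : MeasureTheory.IsFiniteMeasure (MeasureTheory.volume.restrict (Set.Ico 0 D.total)) :=
    ⟨by simp⟩
  obtain ⟨x, hx, m, hm, hmx⟩ := (measurePreserving_map (D := D)).exists_mem_iterate_mem
    measurableSet_Ico.nullMeasurableSet hmeas
  exact (hW x hx).2.2 m (Nat.pos_of_ne_zero hm) (hW _ hmx).1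

/-- The points of the domain whose forward orbit meets `J`. -/
def hits (D : IEM A) (J : Set ℝ) : Set ℝ :=
  {x | x ∈ Set.Ico 0 D.total ∧ ∃ k, D.map^[k] x ∈ J}

/-- Return times of the inverse map are bounded: from the first entrance into `J`, going back more
than that bound would meet an earlier visit to `J`. -/
lemma exists_hitting_bound [Nonempty A] {c d : ℝ} (hJ : Set.Ico c d ⊆ Set.Ico 0 D.total) :
    ∃ N, ∀ x ∈ D.hits (Set.Ico c d), ∃ k ≤ N, D.map^[k] x ∈ Set.Ico c d := by
  classical
  obtain ⟨N, hN⟩ := exists_return_bound (D := D.symm) hJ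
  refine ⟨N, fun x hx => ?_⟩
  have hs := Nat.find_spec hx.2
  refine ⟨Nat.find hx.2, ?_, hs⟩
  by_contra! hlt
  obtain ⟨n, hn0, hnN, hn⟩ := hN _ hs
  obtain ⟨i, hi⟩ := Nat.exists_eq_add_of_le (hnN.trans hlt.le)
  rw [hi, Function.iterate_add_apply, symm_iterate_map (iterate_map_mem hx.1 i)] at hn
  exact Nat.find_min hx.2 (by omega) hn

/-- Hitting is decided within a uniformly bounded time, during which nearby points to the right
share the itinerary. -/
lemma rightConst_hits [Nonempty A] {c d : ℝ} (hJ : Set.Ico c d ⊆ Set.Ico 0 D.total) :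
    D.RightConst (D.hits (Set.Ico c d)) := by
  intro x hx
  obtain ⟨N, hN⟩ := exists_hitting_bound hJ
  obtain ⟨e, he, h⟩ := exists_iterate_map_add_eq (rightConst_Ico c d) N x hx
  refine ⟨e, he, fun s hs hse => ⟨fun hxs => ⟨hx, ?_⟩, fun hxs => ⟨?_, ?_⟩⟩⟩
  · obtain ⟨k, hk, hkJ⟩ := hN _ hxs
    obtain ⟨h1, -, h2⟩ := h s hs hse k hk
    exact ⟨k, by rwa [h1, h2] at hkJ⟩
  · exact (h s hs hse 0 (Nat.zero_le N)).2.1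
  · obtain ⟨k, hk, hkJ⟩ := hN _ hxs
    obtain ⟨h1, -, h2⟩ := h s hs hse k hk
    exact ⟨k, by rwa [h1, h2]⟩

end IEM

/-! ### Self-similarity: aperiodicity, towers, primitivity -/

namespace IEM

variable {A : Type*} [Fintype A] {D : IEM A} {α : ℝ} {r : A → ℕ}

lemma left_label_zero [Nonempty A] : D.left (D.label 0) = 0 :=
  le_antisymm (mem_interval_label ⟨le_rfl, D.total_pos⟩).1 (D.left_nonneg _)

lemma IsSelfSimilar.pow_pos (hD : D.IsSelfSimilar α) (n : ℕ) : 0 < α ^ n := _root_.pow_pos hD.pos n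

lemma IsSelfSimilar.pow_le_one (hD : D.IsSelfSimilar α) (n : ℕ) : α ^ n ≤ 1 :=
  pow_le_one₀ hD.pos.le hD.lt_one.le

lemma IsSelfSimilar.exists_pow_le (hD : D.IsSelfSimilar α) {x : ℝ} (hx : 0 < x) :
    ∃ n, α ^ n ≤ x :=
  (exists_pow_lt_of_lt_one hx hD.lt_one).imp fun _ h => h.le

lemma IsSelfSimilar.Ico_pow_subset (hD : D.IsSelfSimilar α) (n : ℕ) :
    Set.Ico 0 (α ^ n) ⊆ Set.Ico 0 D.total :=
  Set.Ico_subset_Ico_right (hD.total_eq ▸ hD.pow_le_one n)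

lemma IsSelfSimilar.mul_mem (hD : D.IsSelfSimilar α) {x : ℝ} (hx : x ∈ Set.Ico 0 D.total)
    (n : ℕ) : α ^ n * x ∈ Set.Ico 0 (α ^ n) := by
  rw [hD.total_eq] at hx
  exact ⟨mul_nonneg (hD.pow_pos n).le hx.1, mul_lt_of_lt_one_right (hD.pow_pos n) hx.2⟩

lemma IsSelfSimilar.exists_eq_mul (hD : D.IsSelfSimilar α) {n : ℕ} {z : ℝ}
    (hz : z ∈ Set.Ico 0 (α ^ n)) : ∃ x ∈ Set.Ico 0 D.total, z = α ^ n * x := by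
  refine ⟨(α ^ n)⁻¹ * z, ?_, (mul_inv_cancel_left₀ (hD.pow_pos n).ne' z).symm⟩
  rw [hD.total_eq]
  exact (mem_Ico_iff_inv_mul_mem (hD.pow_pos n) z).1 (by rwa [mul_one])

lemma map_eq_self_of_delta_eq_zero [Nonempty A] (hD : D.IsSelfSimilar α)
    (hr : D.HasReturnTimes α r) (h0 : D.delta (D.label 0) = 0) {x : ℝ}
    (hx : x ∈ Set.Ico 0 D.total) : D.map x = x := by
  classical
  obtain ⟨n, hn⟩ := hD.exists_pow_le (D.len_pos (D.label 0))
  have ht := hD.mul_mem hx n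
  have hfix : D.map (α ^ n * x) = α ^ n * x := by
    rw [map_of_mem (a := D.label 0), h0, add_zero]
    rw [mem_interval, left_label_zero]
    exact ⟨ht.1, by linarith [ht.2]⟩
  obtain ⟨N, -, he, -⟩ := induces_rescaledMap_pow hD hr n _ ht
  have := iterate_rescaledMap (D := D) (hD.pow_pos n).ne' 1 x
  rw [Function.iterate_one, Function.iterate_one] at this
  rw [Function.iterate_fixed hfix, this] at he
  exact (mul_left_cancel₀ (hD.pow_pos n).ne' he).symm

section Aperiodic

open Function

lemma aperiodic_of_delta_ne_zero [Nonempty A] (hD : D.IsSelfSimilar α)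
    (hr : D.HasReturnTimes α r) (h0 : D.delta (D.label 0) ≠ 0) : D.Aperiodic := by
  classical
  intro x hx p hp hxp
  set S := {q | ∃ y ∈ Set.Ico 0 D.total, y ∈ periodicPts D.map ∧ q = minimalPeriod D.map y} with hS
  have hfin : S.Finite := by
    refine (Set.finite_range fun a => minimalPeriod D.map (D.left a)).subset ?_
    rintro q ⟨y, hy, hyp, rfl⟩
    obtain ⟨a, ha⟩ := exists_minimalPeriod_eq hy hyp
    exact ⟨a, ha.symm⟩
  have hne : S.Nonempty := ⟨_, x, hx, ⟨p, hp, hxp⟩, rfl⟩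
  obtain ⟨y, hy, hyp, hq⟩ := Nat.sSup_mem hne hfin.bddAbove
  set q := sSup S
  have hqpos : 0 < q := hq ▸ minimalPeriod_pos_of_mem_periodicPts hyp
  have hyq : D.map^[q] y = y := hq ▸ isPeriodicPt_minimalPeriod _ _
  have hδ : 0 < D.delta (D.label 0) := by
    refine lt_of_le_of_ne ?_ h0.symm
    rw [delta, left_label_zero, sub_zero]
    exact D.leftImage_nonneg _
  -- At this scale `[0, α ^ n)` lies in the leftmost interval and is moved off itself, so every
  -- return takes at least two steps.
  obtain ⟨n, hn⟩ := hD.exists_pow_le (lt_min (D.len_pos (D.label 0)) hδ)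
  have hn1 := hn.trans (min_le_left _ _)
  have hn2 := hn.trans (min_le_right _ _)
  have htwo : ∀ t ∈ Set.Ico 0 (α ^ n), ∀ m, IsFirstReturnTime D.map (Set.Ico 0 (α ^ n)) t m →
      2 ≤ m := by
    intro t ht m hm
    by_contra! hlt
    obtain rfl : m = 1 := by have := hm.1; omega
    have := hm.2.1
    rw [iterate_one, map_of_mem (a := D.label 0)] at this
    · linarith [this.2, ht.1]
    · rw [mem_interval, left_label_zero]
      exact ⟨ht.1, by linarith [ht.2]⟩
  have hI := induces_rescaledMap_pow hD hr n
  have ht := hD.mul_mem hy n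
  obtain ⟨N, hN, -, he, -⟩ := hI.exists_iterate htwo ht q
  have htN : D.map^[N] (α ^ n * y) = α ^ n * y := by
    rw [he, iterate_rescaledMap (hD.pow_pos n).ne', hyq]
  have htper : α ^ n * y ∈ periodicPts D.map := ⟨N, by omega, htN⟩
  have hppos := minimalPeriod_pos_of_mem_periodicPts htper
  have hpt : D.map^[minimalPeriod D.map (α ^ n * y)] (α ^ n * y) = α ^ n * y :=
    isPeriodicPt_minimalPeriod _ _
  -- A period of the scaled point is at least `2 * j` with `j` a positive period of `y`, hence at
  -- least `2 * q`, whereas `q` is maximal.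
  obtain ⟨j, hj, hj0, hje⟩ := hI.exists_eq_iterate (by norm_num) htwo ht (hpt.symm ▸ ht)
  rw [hpt, iterate_rescaledMap (hD.pow_pos n).ne'] at hje
  have hjy := mul_left_cancel₀ (hD.pow_pos n).ne' hje
  have h1 : q ≤ j := hq ▸ IsPeriodicPt.minimalPeriod_le (hj0 hppos) hjy.symm
  have h2 : minimalPeriod D.map (α ^ n * y) ≤ q :=
    le_csSup hfin.bddAbove ⟨_, hD.Ico_pow_subset n ht, htper, rfl⟩
  omega

end Aperiodic

lemma iterate_mul_pow_mem [Nonempty A] (hD : D.IsSelfSimilar α) (hr : D.HasReturnTimes α r)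
    {n k : ℕ} {x : ℝ} (hx : x ∈ Set.Ico 0 D.total)
    (hk : D.map^[k] (α ^ n * x) ∈ Set.Ico 0 (α ^ n)) :
    ∃ j, D.map^[k] (α ^ n * x) = α ^ n * D.map^[j] x := by
  classical
  obtain ⟨j, -, -, hj⟩ := (induces_rescaledMap_pow hD hr n).exists_eq_iterate le_rfl
    Induces.one_le (hD.mul_mem hx n) hk
  exact ⟨j, by rw [hj, iterate_rescaledMap (hD.pow_pos n).ne']⟩

lemma exists_iterate_mul_pow [Nonempty A] (hD : D.IsSelfSimilar α) (hr : D.HasReturnTimes α r)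
    (n j : ℕ) {x : ℝ} (hx : x ∈ Set.Ico 0 D.total) :
    ∃ k, D.map^[k] (α ^ n * x) = α ^ n * D.map^[j] x := by
  classical
  obtain ⟨N, -, -, he, -⟩ := (induces_rescaledMap_pow hD hr n).exists_iterate
    Induces.one_le (hD.mul_mem hx n) j
  exact ⟨N, by rw [he, iterate_rescaledMap (hD.pow_pos n).ne']⟩

lemma map_mem_hits_pow [Nonempty A] (hD : D.IsSelfSimilar α) (hr : D.HasReturnTimes α r) {n : ℕ}
    {x : ℝ} (hx : x ∈ D.hits (Set.Ico 0 (α ^ n))) : D.map x ∈ D.hits (Set.Ico 0 (α ^ n)) := by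
  classical
  obtain ⟨hxX, k, hk⟩ := hx
  refine ⟨map_mem hxX, ?_⟩
  cases k with
  | zero =>
    obtain ⟨N, hN, -⟩ := induces_rescaledMap_pow hD hr n x hk
    refine ⟨N - 1, ?_⟩
    rw [← Function.iterate_succ_apply, Nat.succ_eq_add_one, Nat.sub_add_cancel hN.1]
    exact hN.2.1
  | succ k => exact ⟨k, by rwa [← Function.iterate_succ_apply]⟩

/-- If the orbit of `x` avoids `[0, α)`, then `α ^ n * x` hits `[0, α ^ n)` but not `[0, α ^ (n +
1))`. The differences of consecutive hitting sets would be infinitely many disjoint invariant sets,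
each containing a left endpoint. -/
lemma exists_iterate_mem_Ico [Nonempty A] (hD : D.IsSelfSimilar α) (hr : D.HasReturnTimes α r)
    (hap : D.Aperiodic) {x : ℝ} (hx : x ∈ Set.Ico 0 D.total) : ∃ k, D.map^[k] x ∈ Set.Ico 0 α := by
  by_contra! hcon
  have hsub : ∀ {m n : ℕ}, m ≤ n → D.hits (Set.Ico 0 (α ^ n)) ⊆ D.hits (Set.Ico 0 (α ^ m)) :=
    fun hmn y hy => ⟨hy.1, hy.2.imp fun k hk =>
      Set.Ico_subset_Ico_right (pow_le_pow_of_le_one hD.pos.le hD.lt_one.le hmn) hk⟩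
  have key : ∀ n, ∃ a, D.left a ∈ D.hits (Set.Ico 0 (α ^ n)) \ D.hits (Set.Ico 0 (α ^ (n + 1))) := by
    intro n
    have ht := hD.mul_mem hx n
    refine exists_left_mem (x := α ^ n * x) hap ((rightConst_hits (hD.Ico_pow_subset n)).diff
      (rightConst_hits (hD.Ico_pow_subset (n + 1)))) ?_ (hD.Ico_pow_subset n ht)
      ⟨⟨hD.Ico_pow_subset n ht, 0, ht⟩, ?_⟩
    · rintro y hy ⟨h1, h2⟩
      refine ⟨map_mem_hits_pow hD hr h1, fun h3 => h2 ⟨hy, ?_⟩⟩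
      obtain ⟨-, k, hk⟩ := h3
      exact ⟨k + 1, by rwa [Function.iterate_succ_apply]⟩
    · rintro ⟨-, k, hk⟩
      obtain ⟨j, hj⟩ := iterate_mul_pow_mem hD hr hx (Set.Ico_subset_Ico_right
        (pow_le_pow_of_le_one hD.pos.le hD.lt_one.le n.le_succ) hk)
      rw [hj, pow_succ] at hk
      refine hcon j ⟨(iterate_map_mem hx j).1, ?_⟩
      exact lt_of_mul_lt_mul_left hk.2 (hD.pow_pos n).le
  choose f hf using key
  refine not_injective_infinite_finite f fun m n hmn => ?_
  by_contra hne
  wlog hlt : m < n generalizing m n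
  · exact this n m hmn.symm (Ne.symm hne) (by omega)
  exact (hf m).2 (hsub hlt (hmn ▸ (hf n).1))

lemma exists_iterate_mem_Ico_pow [Nonempty A] (hD : D.IsSelfSimilar α)
    (hr : D.HasReturnTimes α r) (hap : D.Aperiodic) (n : ℕ) :
    ∀ x ∈ Set.Ico 0 D.total, ∃ k, D.map^[k] x ∈ Set.Ico 0 (α ^ n) := by
  induction n with
  | zero => exact fun x hx => ⟨0, by rwa [pow_zero, ← hD.total_eq]⟩
  | succ n ih =>
    intro x hx
    obtain ⟨k, hk⟩ := ih x hx
    obtain ⟨z, hz, hkz⟩ := hD.exists_eq_mul hk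
    obtain ⟨j, hj⟩ := exists_iterate_mem_Ico hD hr hap hz
    obtain ⟨i, hi⟩ := exists_iterate_mul_pow hD hr n j hz
    refine ⟨i + k, ?_⟩
    rw [Function.iterate_add_apply, hkz, hi, pow_succ]
    exact ⟨mul_nonneg (hD.pow_pos n).le hj.1, by gcongr; exacts [hD.pow_pos n, hj.2]⟩

/-- The towers over `[0, α ^ n)` cover the domain. -/
lemma exists_eq_iterate [Nonempty A] (hD : D.IsSelfSimilar α) (hr : D.HasReturnTimes α r)
    (hap : D.Aperiodic) (n : ℕ) {y : ℝ} (hy : y ∈ Set.Ico 0 D.total) :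
    ∃ z ∈ Set.Ico 0 (α ^ n), ∃ j, y = D.map^[j] z ∧
      ∀ i, 0 < i → i ≤ j → D.map^[i] z ∉ Set.Ico 0 (α ^ n) := by
  classical
  obtain ⟨k, hk⟩ := exists_iterate_mem_Ico_pow hD hr hap n y hy
  induction k generalizing y with
  | zero => exact ⟨y, hk, 0, rfl, by omega⟩
  | succ k ih =>
    by_cases hyJ : y ∈ Set.Ico 0 (α ^ n)
    · exact ⟨y, hyJ, 0, rfl, by omega⟩
    obtain ⟨z, hz, j, hj, hji⟩ := ih (map_mem hy) (by rwa [← Function.iterate_succ_apply])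
    have hzX := hD.Ico_pow_subset n hz
    cases j with
    | succ j =>
      rw [Function.iterate_succ_apply'] at hj
      exact ⟨z, hz, j, map_injOn hy (iterate_map_mem hzX j) hj, fun i hi hij => hji i hi (by omega)⟩
    -- Here the image of `y` lies in the base, so `y` is the top of a tower: that over the scaled
    -- preimage `α ^ n * D.symm.map x`, which returns exactly at this image.
    | zero =>
      obtain ⟨x, hx, hzx⟩ := hD.exists_eq_mul hz
      have hw := hD.mul_mem (symm_map_mem hx) n
      obtain ⟨N, hN, he, -⟩ := induces_rescaledMap_pow hD hr n _ hw
      have h1 := iterate_rescaledMap (D := D) (hD.pow_pos n).ne' 1 (D.symm.map x)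
      rw [Function.iterate_one, Function.iterate_one, map_symm_map hx, ← hzx] at h1
      obtain ⟨m, rfl⟩ := Nat.exists_eq_add_of_lt hN.1
      rw [h1, zero_add, Function.iterate_succ_apply'] at he
      refine ⟨_, hw, m, map_injOn hy (iterate_map_mem (hD.Ico_pow_subset n hw) m) (hj.trans he.symm),
        fun i hi him => hN.2.2 i hi (by omega)⟩

/-- Towers over arbitrarily small `[0, α ^ n)` reach the interval, so points arbitrarily near `0`
hit it; right constancy at `0` gives the same for `0`. -/
lemma exists_iterate_zero_mem_interval [Nonempty A] (hD : D.IsSelfSimilar α)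
    (hr : D.HasReturnTimes α r) (hap : D.Aperiodic) (a : A) :
    ∃ k, D.map^[k] 0 ∈ D.interval a := by
  by_contra! hcon
  have h0 : (0 : ℝ) ∈ Set.Ico 0 D.total := ⟨le_rfl, D.total_pos⟩
  have hsub : D.interval a ⊆ Set.Ico 0 D.total := fun t ht => mem_Ico_of_mem_interval ht
  obtain ⟨e, he, h⟩ := rightConst_hits hsub 0 h0
  obtain ⟨n, hn⟩ := hD.exists_pow_le he
  obtain ⟨z, hz, j, hj, -⟩ := exists_eq_iterate hD hr hap n
    (mem_Ico_of_mem_interval (left_mem_interval (D := D) a))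
  have hiff := h z hz.1 (hz.2.trans_le hn)
  rw [zero_add] at hiff
  obtain ⟨-, k, hk⟩ := hiff.1 ⟨hD.Ico_pow_subset n hz, j, hj ▸ left_mem_interval a⟩
  exact hcon k hk

/-- The renormalization matrix of an aperiodic self-similar interval exchange is primitive. -/
lemma exists_renormMatrix_pow_pos [Nonempty A] [DecidableEq A] (hD : D.IsSelfSimilar α)
    (hr : D.HasReturnTimes α r) (hap : D.Aperiodic) :
    ∃ n, ∀ a b, 0 < (D.renormMatrix α r ^ n) a b := by
  have h0 : (0 : ℝ) ∈ Set.Ico 0 D.total := ⟨le_rfl, D.total_pos⟩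
  have hcount : ∀ n, ∀ t ∈ Set.Ico 0 (α ^ n), ∀ k a, (∀ i, 0 < i → i ≤ k →
      D.map^[i] t ∉ Set.Ico 0 (α ^ n)) → D.label (D.map^[k] t) = a →
      0 < (D.renormMatrix α r ^ n) a (D.rescaledLabel (α ^ n) t) := by
    intro n t ht k a hk hka
    obtain ⟨N, hN, -, hg⟩ := induces_rescaledMap_pow hD hr n t ht
    have hkN : k < N := by
      by_contra! hle
      exact hk N hN.1 hle hN.2.1
    have := hg fun c => if c = a then 1 else 0
    simp only [ite_mul, one_mul, zero_mul, Finset.sum_ite_eq', Finset.mem_univ, if_true] at this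
    rw [← this]
    exact Finset.sum_pos' (fun _ _ => Nat.zero_le _)
      ⟨k, Finset.mem_range.2 hkN, by rw [if_pos hka]; exact one_pos⟩
  -- At this scale all scaled intervals lie in the leftmost interval, so time zero already counts as
  -- a visit: the row of `D.label 0` is positive.
  obtain ⟨n₁, hn₁⟩ := hD.exists_pow_le (D.len_pos (D.label 0))
  have hrow : ∀ b, 0 < (D.renormMatrix α r ^ n₁) (D.label 0) b := by
    intro b
    have ht := hD.mul_mem (mem_Ico_of_mem_interval (left_mem_interval (D := D) b)) n₁
    have := hcount n₁ _ ht 0 (D.label 0) (by omega) (label_eq (by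
      rw [Function.iterate_zero, id, mem_interval, left_label_zero]
      exact ⟨ht.1, by linarith [ht.2]⟩))
    rwa [rescaledLabel, inv_mul_cancel_left₀ (hD.pow_pos n₁).ne',
      label_eq (left_mem_interval b)] at this
  choose k hk using exists_iterate_zero_mem_interval hD hr hap
  set K := Finset.univ.sup k with hK
  -- By time `K` the orbit of `0` has visited all intervals. A base shorter than the least positive
  -- iterate in this range is not re-entered before, so the column of `D.label 0` is positive. The
  -- endpoint `K + 1` keeps the range nonempty when `K = 0`.
  obtain ⟨i₀, hi₀, hmin⟩ := Finset.exists_min_image (Finset.Icc 1 (K + 1))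
    (fun i => D.map^[i] 0) ⟨1, by simp⟩
  have hpos : ∀ i, 0 < i → 0 < D.map^[i] 0 := fun i hi =>
    lt_of_le_of_ne (iterate_map_mem h0 i).1 (hap 0 h0 i hi).symm
  obtain ⟨n₂, hn₂⟩ := hD.exists_pow_le (hpos i₀ (Finset.mem_Icc.1 hi₀).1)
  have hcol : ∀ a, 0 < (D.renormMatrix α r ^ n₂) a (D.label 0) := by
    intro a
    have := hcount n₂ 0 ⟨le_rfl, hD.pow_pos n₂⟩ (k a) a (fun i hi hik hmem => ?_) (label_eq (hk a))
    · rwa [rescaledLabel, mul_zero] at this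
    · have hle : k a ≤ K := Finset.le_sup (Finset.mem_univ a)
      have := hmin i (Finset.mem_Icc.2 ⟨hi, by omega⟩)
      linarith [hmem.2]
  refine ⟨n₂ + n₁, fun a b => ?_⟩
  rw [pow_add, Matrix.mul_apply]
  exact Finset.sum_pos' (fun _ _ => Nat.zero_le _)
    ⟨D.label 0, Finset.mem_univ _, Nat.mul_pos (hcol a) (hrow b)⟩

end IEM

/-! ### The length vector as an eigenvector -/

namespace IEM

variable {A : Type*} [Fintype A] {D : IEM A} {α : ℝ} {r : A → ℕ}

lemma exists_iterate_eq_add (hr : D.HasReturnTimes α r) (b : A) {k : ℕ} (hk : k ≤ r b) :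
    ∃ c, ∀ t ∈ D.scaledInterval α b, D.map^[k] t = t + c := by
  induction k with
  | zero => exact ⟨0, by simp⟩
  | succ k ih =>
    obtain ⟨c, hc⟩ := ih (by omega)
    obtain ⟨a, ha⟩ := hr.itinerary b k (by omega)
    refine ⟨c + D.delta a, fun t ht => ?_⟩
    rw [Function.iterate_succ_apply', map_of_mem (ha (Set.mem_image_of_mem _ ht)), hc t ht, add_assoc]

open MeasureTheory in
lemma volume_image_scaledInterval (hα : 0 < α) (hr : D.HasReturnTimes α r) (b : A) {k : ℕ}
    (hk : k ≤ r b) : MeasurableSet (D.map^[k] '' D.scaledInterval α b) ∧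
      volume (D.map^[k] '' D.scaledInterval α b) = ENNReal.ofReal (α * D.len b) := by
  obtain ⟨c, hc⟩ := exists_iterate_eq_add hr b hk
  have : D.map^[k] '' D.scaledInterval α b =
      Set.Ico (α * D.left b + c) (α * (D.left b + D.len b) + c) := by
    rw [Set.image_congr hc, scaledInterval, interval, Set.image_mul_left_Ico hα,
      Set.image_add_const_Ico]
  rw [this]
  refine ⟨measurableSet_Ico, ?_⟩
  rw [Real.volume_Ico]
  congr 1
  ring

-- The interval `I_a` is the disjoint union of the tower floors `T^k (α I_b)` inside it, each of
-- length `α * D.len b`; measures are compared.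
open MeasureTheory in
lemma sum_renormMatrix_mul_len [Nonempty A] (hD : D.IsSelfSimilar α) (hr : D.HasReturnTimes α r)
    (hap : D.Aperiodic) (a : A) :
    ∑ b, (D.renormMatrix α r a b : ℝ) * D.len b = α⁻¹ * D.len a := by
  classical
  have hα := hD.pos
  set K : A → Finset ℕ := fun b => (Finset.range (r b)).filter fun k =>
    D.map^[k] '' D.scaledInterval α b ⊆ D.interval a with hK
  have hcard : ∀ b, D.renormMatrix α r a b = (K b).card := by
    intro b
    rw [renormMatrix, Matrix.of_apply, ← Set.ncard_coe_finset]
    congr 1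
    ext k
    simp [hK]
  have hJ : ∀ b, ∀ t ∈ D.scaledInterval α b, t ∈ Set.Ico 0 α := by
    rintro b _ ⟨t, ht, rfl⟩
    simpa using hD.mul_mem (mem_Ico_of_mem_interval ht) 1
  have hJX : Set.Ico 0 α ⊆ Set.Ico 0 D.total := by simpa using hD.Ico_pow_subset 1
  have hunion : D.interval a = ⋃ z ∈ Finset.univ.sigma K,
      D.map^[z.2] '' D.scaledInterval α z.1 := by
    ext y
    simp only [Set.mem_iUnion, exists_prop, Finset.mem_sigma, Finset.mem_univ, true_and, hK,
      Finset.mem_filter, Finset.mem_range]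
    constructor
    · intro hy
      obtain ⟨z, hz, j, hj, hji⟩ := exists_eq_iterate hD hr hap 1 (mem_Ico_of_mem_interval hy)
      obtain ⟨x, hx, hzx⟩ := hD.exists_eq_mul hz
      rw [pow_one] at hji hzx
      have hzb : z ∈ D.scaledInterval α (D.label x) := ⟨x, mem_interval_label hx, hzx.symm⟩
      have hret := hr.returnTime _ z hzb
      have hjr : j < r (D.label x) := by
        by_contra! hle
        exact hji _ hret.1 hle hret.2.1
      obtain ⟨c, hc⟩ := hr.itinerary _ j hjr
      have hyc : y ∈ D.map^[j] '' D.scaledInterval α (D.label x) := hj ▸ Set.mem_image_of_mem _ hzb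
      rw [eq_of_mem_interval (hc hyc) hy] at hc
      exact ⟨⟨D.label x, j⟩, ⟨hjr, hc⟩, hyc⟩
    · rintro ⟨z, ⟨-, hz⟩, hy⟩
      exact hz hy
  have hdisj : (↑(Finset.univ.sigma K) : Set (Σ _ : A, ℕ)).PairwiseDisjoint
      fun z => D.map^[z.2] '' D.scaledInterval α z.1 := by
    rintro ⟨b, k⟩ hbk ⟨c, l⟩ hcl hne
    simp only [Finset.coe_sigma, Set.mem_sigma_iff, Finset.mem_coe, hK, Finset.mem_filter,
      Finset.mem_range] at hbk hcl
    refine Set.disjoint_left.2 ?_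
    rintro _ ⟨s, hs, rfl⟩ ⟨t, ht, hst⟩
    dsimp only at hs ht hst
    have aux : ∀ b c k l s t, s ∈ D.scaledInterval α b → t ∈ D.scaledInterval α c → k ≤ l →
        l < r c → D.map^[l] t = D.map^[k] s → b = c ∧ k = l := by
      intro b c k l s t hs ht hkl hl h
      obtain ⟨i, rfl⟩ := Nat.exists_eq_add_of_le hkl
      rw [Function.iterate_add_apply] at h
      have hts := iterate_map_injOn k (iterate_map_mem (hJX (hJ c t ht)) i) (hJX (hJ b s hs)) h
      have hi : i = 0 := by
        by_contra hi
        exact (hr.returnTime c t ht).2.2 i (by omega) (by omega) (hts ▸ hJ b s hs)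
      subst hi
      obtain ⟨s', hs', rfl⟩ := hs
      obtain ⟨t', ht', rfl⟩ := ht
      rw [Function.iterate_zero, id] at hts
      rw [mul_left_cancel₀ hα.ne' hts] at ht'
      exact ⟨eq_of_mem_interval hs' ht', rfl⟩
    apply hne
    rcases le_total k l with h | h
    · obtain ⟨rfl, rfl⟩ := aux b c k l s t hs ht h hcl.2.1 hst; rfl
    · obtain ⟨rfl, rfl⟩ := aux c b l k t s ht hs h hbk.2.1 hst.symm; rfl
  have hK' : ∀ z ∈ Finset.univ.sigma K, z.2 ≤ r z.1 := fun z hz =>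
    (Finset.mem_range.1 (Finset.mem_filter.1 (Finset.mem_sigma.1 hz).2).1).le
  have hvol : volume (D.interval a) = ∑ z ∈ Finset.univ.sigma K, ENNReal.ofReal (α * D.len z.1) := by
    rw [hunion, measure_biUnion_finset hdisj
      fun z hz => (volume_image_scaledInterval hα hr z.1 (hK' z hz)).1]
    exact Finset.sum_congr rfl fun z hz => (volume_image_scaledInterval hα hr z.1 (hK' z hz)).2
  have hpos : ∀ b, 0 ≤ α * D.len b := fun b => (mul_pos hα (D.len_pos b)).le
  rw [interval, Real.volume_Ico, add_sub_cancel_left, ← ENNReal.ofReal_sum_of_nonneg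
    fun z _ => hpos z.1, ENNReal.ofReal_eq_ofReal_iff (D.len_pos a).le
    (Finset.sum_nonneg fun z _ => hpos z.1), Finset.sum_sigma] at hvol
  rw [hvol, Finset.mul_sum]
  refine Finset.sum_congr rfl fun b _ => ?_
  dsimp only
  rw [Finset.sum_const, nsmul_eq_mul, hcard b, mul_left_comm α⁻¹, inv_mul_cancel_left₀ hα.ne']

end IEM

/-! ### Maximum principles for nonnegative matrices -/

section PerronFrobenius

variable {A : Type*} [Fintype A]

/-- An average with nonnegative weights attains the maximum only if all terms with positive weight do. -/
lemma eq_of_sum_mul_eq {w u : A → ℝ} {C : ℝ} (hw : ∀ b, 0 < w b) (hu : ∀ b, u b ≤ C)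
    (h : ∑ b, w b * u b = (∑ b, w b) * C) (b : A) : u b = C := by
  rw [Finset.sum_mul] at h
  have := (Finset.sum_eq_sum_iff_of_le fun b _ =>
    mul_le_mul_of_nonneg_left (hu b) (hw b).le).1 h b (Finset.mem_univ b)
  exact mul_left_cancel₀ (hw b).ne' this

variable {P : Matrix A A ℝ} {v : A → ℝ} {ρ : ℝ}

/-- At a maximum of `‖x a‖ / v a` the eigenvalue equation makes a weighted average equal to the
maximum. Positive weights force equality everywhere, in modulus and, after rotation, in argument. -/
lemma exists_smul_of_pos (hP : ∀ a b, 0 < P a b) (hv : ∀ a, 0 < v a) (hρ : 0 < ρ)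
    (hPv : P.mulVec v = ρ • v) {x : A → ℂ} {γ : ℂ} (hγ : ‖γ‖ = ρ)
    (hx : (P.map Complex.ofReal).mulVec x = γ • x) : ∃ c : ℂ, x = fun a => c * v a := by
  by_cases hA : Nonempty A
  swap
  · exact ⟨0, funext fun a => absurd ⟨a⟩ hA⟩
  obtain ⟨a, -, hmax⟩ := Finset.exists_max_image Finset.univ (fun a => ‖x a‖ / v a)
    Finset.univ_nonempty
  set C := ‖x a‖ / v a with hC
  have hle : ∀ b, ‖x b‖ ≤ C * v b := fun b => (div_le_iff₀ (hv b)).1 (hmax b (Finset.mem_univ b))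
  by_cases hx0 : x a = 0
  · refine ⟨0, funext fun b => ?_⟩
    have := hle b
    rw [hC, hx0] at this
    simpa using this
  -- rotate so that the coordinate of `γ • x` at `a` is a positive real number
  set z := γ * x a with hz
  have hz0 : z ≠ 0 := mul_ne_zero (by rintro rfl; simp at hγ; linarith) hx0
  set w := (starRingEnd ℂ) z / ‖z‖ with hw
  have hzn : (‖z‖ : ℂ) ≠ 0 := by simpa using hz0
  have hwn : ‖w‖ = 1 := by
    rw [hw, norm_div, RCLike.norm_conj, Complex.norm_real, norm_norm, div_self (by simpa using hz0)]
  have hwz : w * z = ‖z‖ := by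
    rw [hw, div_mul_eq_mul_div, mul_comm, Complex.mul_conj, Complex.normSq_eq_norm_sq]
    field_simp
    push_cast
    ring
  have hre : ∀ b, (w * x b).re / v b ≤ C := fun b => by
    rw [div_le_iff₀ (hv b)]
    calc (w * x b).re ≤ ‖w * x b‖ := Complex.re_le_norm _
      _ = ‖x b‖ := by rw [norm_mul, hwn, one_mul]
      _ ≤ C * v b := hle b
  have hsum : ∑ b, P a b * v b = ρ * v a := by
    have := congrFun hPv a
    simpa [Matrix.mulVec, dotProduct] using this
  have hsumx : ∑ b, (P a b : ℂ) * x b = z := by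
    have := congrFun hx a
    simpa [Matrix.mulVec, dotProduct] using this
  have hall : ∀ b, (w * x b).re / v b = C := by
    refine eq_of_sum_mul_eq (w := fun b => P a b * v b) (fun b => mul_pos (hP a b) (hv b)) hre ?_
    have h1 : ∑ b, P a b * v b * ((w * x b).re / v b) = (w * ∑ b, (P a b : ℂ) * x b).re := by
      rw [Finset.mul_sum, Complex.re_sum]
      refine Finset.sum_congr rfl fun b _ => ?_
      rw [mul_left_comm w, Complex.re_ofReal_mul]
      have := (hv b).ne'
      field_simp
    rw [h1, hsumx, hwz, Complex.ofReal_re, hsum, hz, norm_mul, hγ, hC]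
    have := (hv a).ne'
    field_simp
  have hw0 : w ≠ 0 := by rintro h; rw [h, norm_zero] at hwn; exact zero_ne_one hwn
  refine ⟨C / w, funext fun b => ?_⟩
  have h1 : (w * x b).re = C * v b := (div_eq_iff (hv b).ne').1 (hall b)
  have h2 : ‖w * x b‖ ≤ (w * x b).re := by rw [norm_mul, hwn, one_mul, h1]; exact hle b
  have h3 : w * x b = ((C * v b : ℝ) : ℂ) := by
    rw [← h1]
    have h4 : |(w * x b).re| = ‖w * x b‖ :=
      le_antisymm (Complex.abs_re_le_norm _) (h2.trans (le_abs_self _))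
    have h5 := Complex.abs_re_eq_norm.1 h4
    exact Complex.ext (by simp) (by simpa using h5)
  rw [div_mul_eq_mul_div, eq_div_iff hw0, mul_comm, h3]
  push_cast
  rfl

/-- This excludes a Jordan chain above `v`: after rotation, the equation at a maximum of the real
part of `x` relative to `v` would exceed the maximum. -/
lemma eq_zero_of_mulVec_eq_add (hP : ∀ a b, 0 ≤ P a b) (hv : ∀ a, 0 < v a)
    (hPv : P.mulVec v = ρ • v) [Nonempty A] {x : A → ℂ} {c : ℂ}
    (hx : (P.map Complex.ofReal).mulVec x = fun a => ρ * x a + c * v a) : c = 0 := by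
  by_contra hc
  -- rotate so that `c` becomes a positive real number
  set w := (starRingEnd ℂ) c with hw
  have hwc : w * c = ((Complex.normSq c : ℝ) : ℂ) := by rw [mul_comm, Complex.mul_conj]
  obtain ⟨a, -, hmax⟩ := Finset.exists_max_image Finset.univ (fun a => (w * x a).re / v a)
    Finset.univ_nonempty
  set C := (w * x a).re / v a with hC
  have hle : ∀ b, (w * x b).re ≤ C * v b :=
    fun b => (div_le_iff₀ (hv b)).1 (hmax b (Finset.mem_univ b))
  have hsum : ∑ b, P a b * v b = ρ * v a := by
    have := congrFun hPv a
    simpa [Matrix.mulVec, dotProduct] using this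
  have hsumx : ∑ b, (P a b : ℂ) * x b = ρ * x a + c * v a := by
    have := congrFun hx a
    simpa [Matrix.mulVec, dotProduct] using this
  have h1 : ∑ b, P a b * (w * x b).re = (w * ∑ b, (P a b : ℂ) * x b).re := by
    rw [Finset.mul_sum, Complex.re_sum]
    refine Finset.sum_congr rfl fun b _ => ?_
    rw [mul_left_comm w, Complex.re_ofReal_mul]
  have h2 : (w * (ρ * x a + c * v a)).re = ρ * (w * x a).re + Complex.normSq c * v a := by
    rw [mul_add, mul_left_comm w, ← mul_assoc w c, hwc, Complex.add_re, Complex.re_ofReal_mul,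
      Complex.re_ofReal_mul, Complex.ofReal_re]
  have h3 : ∑ b, P a b * (w * x b).re ≤ ∑ b, P a b * (C * v b) :=
    Finset.sum_le_sum fun b _ => mul_le_mul_of_nonneg_left (hle b) (hP a b)
  have h4 : ∑ b, P a b * (C * v b) = ρ * (w * x a).re := by
    simp only [mul_left_comm _ C]
    rw [← Finset.mul_sum, hsum, hC]
    have := (hv a).ne'
    field_simp
  rw [h1, hsumx, h2, h4] at h3
  have := mul_pos (Complex.normSq_pos.2 hc) (hv a)
  linarith

end PerronFrobenius

lemma map_mulVec_ofReal {A : Type*} [Fintype A] {R : Matrix A A ℕ} {v : A → ℝ} {ρ : ℝ}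
    (hR : (R.map ((↑) : ℕ → ℝ)).mulVec v = ρ • v) :
    (R.map ((↑) : ℕ → ℂ)).mulVec (fun a => (v a : ℂ)) = (ρ : ℂ) • fun a => (v a : ℂ) := by
  ext a
  have := congrFun hR a
  simp only [Matrix.mulVec, dotProduct, Matrix.map_apply, Pi.smul_apply, smul_eq_mul] at this ⊢
  exact_mod_cast this

/-! ### Simple eigenvalues, and their transfer by an invariant form -/

section Multiplicity

open Module

variable {A : Type*} [Fintype A] [DecidableEq A]

lemma exists_mulVec_eq_smul_of_isRoot {Q : Matrix A A ℂ} {γ : ℂ} (h : Q.charpoly.IsRoot γ) :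
    ∃ x : A → ℂ, x ≠ 0 ∧ Q.mulVec x = γ • x := by
  rw [← Matrix.charpoly_toLin', ← End.hasEigenvalue_iff_isRoot_charpoly] at h
  obtain ⟨x, hx⟩ := h.exists_hasEigenvector
  exact ⟨x, hx.2, by simpa using hx.apply_eq_smul⟩

lemma isRoot_charpoly_of_mulVec_eq_smul {Q : Matrix A A ℂ} {γ : ℂ} {x : A → ℂ} (hx : x ≠ 0)
    (h : Q.mulVec x = γ • x) : Q.charpoly.IsRoot γ := by
  rw [← Matrix.charpoly_toLin', ← End.hasEigenvalue_iff_isRoot_charpoly]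
  refine End.hasEigenvalue_of_hasEigenvector (x := x) ⟨End.mem_eigenspace_iff.2 ?_, hx⟩
  simpa using h

/-- A one-dimensional eigenspace without Jordan chains of length two belongs to a simple root. -/
lemma rootMultiplicity_charpoly_eq_one {Q : Matrix A A ℂ} {μ : ℂ} {v : A → ℂ} (hv : v ≠ 0)
    (hQv : Q.mulVec v = μ • v) (h1 : ∀ x, Q.mulVec x = μ • x → ∃ c : ℂ, x = c • v)
    (h2 : ∀ x y, Q.mulVec x = μ • x + y → Q.mulVec y = μ • y → y = 0) :
    Q.charpoly.rootMultiplicity μ = 1 := by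
  rw [← Matrix.charpoly_toLin', ← LinearMap.finrank_maxGenEigenspace_eq]
  have hspan : End.maxGenEigenspace (Matrix.toLin' Q) μ = Submodule.span ℂ {v} := by
    apply le_antisymm
    · intro x hx
      obtain ⟨k, hk⟩ := (End.mem_maxGenEigenspace _ _ _).1 hx
      have key : ∀ k, ((Matrix.toLin' Q - μ • 1 : End ℂ (A → ℂ)) ^ k) x = 0 →
          (Matrix.toLin' Q - μ • 1 : End ℂ (A → ℂ)) x = 0 := by
        intro k
        induction k with
        | zero => intro h; have h : x = 0 := by simpa using h
                  rw [h, map_zero]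
        | succ k ih =>
          intro h
          cases k with
          | zero => simpa using h
          | succ k =>
            apply ih
            rw [pow_succ', pow_succ'] at h
            rw [pow_succ']
            set z := ((Matrix.toLin' Q - μ • 1 : End ℂ (A → ℂ)) ^ k) x
            have h3 : (Matrix.toLin' Q - μ • 1 : End ℂ (A → ℂ))
              ((Matrix.toLin' Q - μ • 1 : End ℂ (A → ℂ)) z) = 0 := h
            refine h2 z _ ?_ ?_
            · simp [z]
            · simpa [sub_eq_zero, -map_sub, LinearMap.sub_apply] using h3
      have h := key k hk
      obtain ⟨c, rfl⟩ := h1 x (by simpa [sub_eq_zero] using h)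
      exact Submodule.smul_mem _ _ (Submodule.mem_span_singleton_self v)
    · rw [Submodule.span_singleton_le_iff_mem, End.mem_maxGenEigenspace]
      exact ⟨1, by simp [hQv]⟩
  rw [hspan, finrank_span_singleton hv]

lemma finrank_eigenspace_eq_one {Q : Matrix A A ℂ} {μ : ℂ}
    (h : Q.charpoly.rootMultiplicity μ = 1) :
    finrank ℂ (End.eigenspace (Matrix.toLin' Q) μ) = 1 := by
  apply le_antisymm
  · rw [← h, ← Matrix.charpoly_toLin']
    exact LinearMap.finrank_eigenspace_le _ _
  · obtain ⟨x, hx0, hx⟩ := exists_mulVec_eq_smul_of_isRoot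
      (Polynomial.rootMultiplicity_pos'.1 (h ▸ one_pos)).2
    rw [Nat.one_le_iff_ne_zero, ← Nat.pos_iff_ne_zero, Module.finrank_pos_iff_exists_ne_zero]
    exact ⟨⟨x, End.mem_eigenspace_iff.2 (by simpa using hx)⟩, by simpa using hx0⟩

lemma eq_zero_of_rootMultiplicity_eq_one {Q : Matrix A A ℂ} {μ : ℂ}
    (h : Q.charpoly.rootMultiplicity μ = 1) {x y : A → ℂ} (hx : Q.mulVec x = μ • x + y)
    (hy : Q.mulVec y = μ • y) : y = 0 := by
  have heq : End.eigenspace (Matrix.toLin' Q) μ = End.maxGenEigenspace (Matrix.toLin' Q) μ := by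
    refine Submodule.eq_of_le_of_finrank_eq (End.genEigenspace_le_maximal _ _ 1) ?_
    rw [finrank_eigenspace_eq_one h, LinearMap.finrank_maxGenEigenspace_eq, Matrix.charpoly_toLin', h]
  have hmem : x ∈ End.maxGenEigenspace (Matrix.toLin' Q) μ := by
    rw [End.mem_maxGenEigenspace]
    refine ⟨2, ?_⟩
    rw [pow_two, Module.End.mul_apply]
    have : (Matrix.toLin' Q - μ • 1 : End ℂ (A → ℂ)) x = y := by simp [hx]
    rw [this]
    simp [hy]
  rw [← heq, End.mem_eigenspace_iff] at hmem
  have : Q.mulVec x = μ • x := by simpa using hmem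
  rw [this] at hx
  simpa using hx

lemma exists_smul_eq_of_rootMultiplicity_eq_one {Q : Matrix A A ℂ} {μ : ℂ}
    (h : Q.charpoly.rootMultiplicity μ = 1) {x y : A → ℂ} (hx0 : x ≠ 0) (hx : Q.mulVec x = μ • x)
    (hy : Q.mulVec y = μ • y) : ∃ c : ℂ, c • x = y := by
  have := (finrank_eq_one_iff_of_nonzero' (K := ℂ) (V := End.eigenspace (Matrix.toLin' Q) μ)
    ⟨x, End.mem_eigenspace_iff.2 (by simpa using hx)⟩ (by simpa using hx0)).1
    (finrank_eigenspace_eq_one h) ⟨y, End.mem_eigenspace_iff.2 (by simpa using hy)⟩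
  obtain ⟨c, hc⟩ := this
  exact ⟨c, congrArg Subtype.val hc⟩

lemma pow_mulVec_eq_smul {K : Type*} [CommRing K] {Q : Matrix A A K} {μ : K} {v : A → K}
    (h : Q.mulVec v = μ • v) (n : ℕ) : (Q ^ n).mulVec v = μ ^ n • v := by
  induction n with
  | zero => simp
  | succ n ih => rw [pow_succ, ← Matrix.mulVec_mulVec, h, Matrix.mulVec_smul, ih, smul_smul, pow_succ,
      mul_comm]

variable {R : Matrix A A ℕ} {v : A → ℝ} {ρ : ℝ}

/-- The strictly positive case is applied to `R ^ N`, with `γ ^ N` and `ρ ^ N`. -/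
lemma exists_eq_smul_of_primitive {N : ℕ} (hN : ∀ a b, 0 < (R ^ N) a b) (hv : ∀ a, 0 < v a)
    (hρ : 0 < ρ) (hR : (R.map ((↑) : ℕ → ℝ)).mulVec v = ρ • v) {x : A → ℂ} {γ : ℂ} (hγ : ‖γ‖ = ρ)
    (hx : (R.map ((↑) : ℕ → ℂ)).mulVec x = γ • x) : ∃ c : ℂ, x = c • fun a => (v a : ℂ) := by
  have hmap : ((R.map ((↑) : ℕ → ℝ)) ^ N).map Complex.ofReal = (R.map ((↑) : ℕ → ℂ)) ^ N := by
    have h1 := Matrix.map_pow (R.map ((↑) : ℕ → ℝ)) Complex.ofRealHom N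
    have h2 : (R.map ((↑) : ℕ → ℝ)).map Complex.ofRealHom = R.map ((↑) : ℕ → ℂ) := by
      ext a b; simp
    rw [h2] at h1
    exact h1
  have hmapR : (R ^ N).map ((↑) : ℕ → ℝ) = (R.map ((↑) : ℕ → ℝ)) ^ N :=
    Matrix.map_pow R (Nat.castRingHom ℝ) N
  refine exists_smul_of_pos (P := (R.map ((↑) : ℕ → ℝ)) ^ N) (γ := γ ^ N) (fun a b => ?_) hv
    (pow_pos hρ N) (pow_mulVec_eq_smul hR N) (by rw [norm_pow, hγ]) ?_
  · rw [← hmapR]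
    rw [Matrix.map_apply]
    exact_mod_cast hN a b
  · rw [hmap]
    exact pow_mulVec_eq_smul hx N

/-- The Perron-Frobenius eigenvalue is a simple root of the characteristic polynomial. -/
lemma rootMultiplicity_eq_one_of_primitive [Nonempty A] {N : ℕ} (hN : ∀ a b, 0 < (R ^ N) a b)
    (hv : ∀ a, 0 < v a) (hρ : 0 < ρ) (hR : (R.map ((↑) : ℕ → ℝ)).mulVec v = ρ • v) :
    (R.map ((↑) : ℕ → ℂ)).charpoly.rootMultiplicity (ρ : ℂ) = 1 := by
  have hnorm : ‖(ρ : ℂ)‖ = ρ := by rw [Complex.norm_real, Real.norm_of_nonneg hρ.le]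
  refine rootMultiplicity_charpoly_eq_one (v := fun a => (v a : ℂ)) ?_ (map_mulVec_ofReal hR)
    (fun x hx => exists_eq_smul_of_primitive hN hv hρ hR hnorm hx) fun x y hx hy => ?_
  · intro h
    have := congrFun h (Classical.arbitrary A)
    simp only [Pi.zero_apply, Complex.ofReal_eq_zero] at this
    exact (hv _).ne' this
  · obtain ⟨c, rfl⟩ := exists_eq_smul_of_primitive hN hv hρ hR hnorm hy
    have hmap : (R.map ((↑) : ℕ → ℝ)).map Complex.ofReal = R.map ((↑) : ℕ → ℂ) := by
      ext a b; simp
    have := eq_zero_of_mulVec_eq_add (P := R.map ((↑) : ℕ → ℝ)) (fun a b => by simp) hv hR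
      (x := x) (c := c) (by rw [hmap, hx]; rfl)
    rw [this, zero_smul]

/-- No other eigenvalue has a power in common with the Perron-Frobenius eigenvalue. -/
lemma eq_of_pow_eq_of_primitive {N : ℕ} (hN : ∀ a b, 0 < (R ^ N) a b)
    (hv : ∀ a, 0 < v a) (hρ : 0 < ρ) (hR : (R.map ((↑) : ℕ → ℝ)).mulVec v = ρ • v) {γ : ℂ}
    (hγ : (R.map ((↑) : ℕ → ℂ)).charpoly.IsRoot γ) {n : ℕ} (hn : 0 < n)
    (h : γ ^ n = (ρ : ℂ) ^ n) : γ = ρ := by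
  obtain ⟨x, hx0, hx⟩ := exists_mulVec_eq_smul_of_isRoot hγ
  have hnorm : ‖γ‖ = ρ := by
    have := congrArg norm h
    rw [norm_pow, norm_pow, Complex.norm_real, Real.norm_of_nonneg hρ.le] at this
    exact (pow_left_inj₀ (norm_nonneg γ) hρ.le hn.ne').1 this
  obtain ⟨c, rfl⟩ := exists_eq_smul_of_primitive hN hv hρ hR hnorm hx
  rw [Matrix.mulVec_smul, map_mulVec_ofReal hR, smul_comm] at hx
  obtain ⟨a, ha⟩ := Function.ne_iff.1 hx0
  exact mul_right_cancel₀ ha (congrFun hx a).symm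

/-- An invariant form with a good kernel transfers the simplicity of `α⁻¹` to `α`. -/
lemma rootMultiplicity_eq_one_of_form {α : ℝ} (hα : 0 < α) {Q : Matrix A A ℂ}
    (Ω : (A → ℂ) →ₗ[ℂ] (A → ℂ)) (hΩ : ∀ v, Q.transpose.mulVec (Ω (Q.mulVec v)) = Ω v)
    (hker : ∀ (x : A → ℂ) (γ : ℂ) (n : ℕ), 0 < n → Q.mulVec x = γ • x → Ω x = 0 →
      γ ^ n = (α : ℂ) ^ n → x = 0)
    (hsimple : Q.charpoly.rootMultiplicity (α : ℂ)⁻¹ = 1) (hroot : Q.charpoly.IsRoot (α : ℂ)) :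
    Q.charpoly.rootMultiplicity (α : ℂ) = 1 := by
  have hα0 : (α : ℂ) ≠ 0 := by exact_mod_cast hα.ne'
  rw [← Matrix.charpoly_transpose] at hsimple
  have hker1 : ∀ x, Q.mulVec x = (α : ℂ) • x → Ω x = 0 → x = 0 := fun x hx h =>
    hker x α 1 one_pos hx h rfl
  have hmap : ∀ x, Q.mulVec x = (α : ℂ) • x → Q.transpose.mulVec (Ω x) = (α : ℂ)⁻¹ • Ω x := by
    intro x hx
    have := hΩ x
    rw [hx, map_smul, Matrix.mulVec_smul] at this
    conv_rhs => rw [← this, smul_smul, inv_mul_cancel₀ hα0, one_smul]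
  obtain ⟨v, hv0, hv⟩ := exists_mulVec_eq_smul_of_isRoot hroot
  refine rootMultiplicity_charpoly_eq_one hv0 hv (fun x hx => ?_) fun x y hx hy => ?_
  · obtain ⟨c, hc⟩ := exists_smul_eq_of_rootMultiplicity_eq_one hsimple
      (fun h => hv0 (hker1 v hv h)) (hmap v hv) (hmap x hx)
    refine ⟨c, sub_eq_zero.1 (hker1 _ ?_ ?_)⟩
    · rw [Matrix.mulVec_sub, Matrix.mulVec_smul, hx, hv, smul_sub, smul_comm]
    · rw [map_sub, map_smul, hc, sub_self]
  · have h := hΩ x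
    rw [hx, map_add, map_smul, Matrix.mulVec_add, Matrix.mulVec_smul, hmap y hy] at h
    -- A Jordan chain of `Q` at `α` becomes one of its transpose at `α⁻¹`, excluded by simplicity
    -- there.
    have h' : Q.transpose.mulVec (Ω x) = (α : ℂ)⁻¹ • Ω x + (-((α : ℂ)⁻¹ * (α : ℂ)⁻¹)) • Ω y := by
      conv_rhs => rw [← h, smul_add, smul_smul, inv_mul_cancel₀ hα0, one_smul, smul_smul, neg_smul,
        add_neg_cancel_right]
    have h0 := eq_zero_of_rootMultiplicity_eq_one hsimple h' (by
      rw [Matrix.mulVec_smul, hmap y hy, smul_comm])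
    refine hker1 y hy ((smul_eq_zero.1 h0).resolve_left ?_)
    exact neg_ne_zero.2 (mul_ne_zero (inv_ne_zero hα0) (inv_ne_zero hα0))

/-- For an eigenvector `x` for `γ`, the kernel condition gives `Ω x ≠ 0`, so `γ⁻¹` is an eigenvalue
of the transpose and shares a power with `α⁻¹`. -/
lemma eq_of_pow_eq_of_form {α : ℝ} (hα : 0 < α) {Q : Matrix A A ℂ}
    (Ω : (A → ℂ) →ₗ[ℂ] (A → ℂ)) (hΩ : ∀ v, Q.transpose.mulVec (Ω (Q.mulVec v)) = Ω v)
    (hker : ∀ (x : A → ℂ) (γ : ℂ) (n : ℕ), 0 < n → Q.mulVec x = γ • x → Ω x = 0 →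
      γ ^ n = (α : ℂ) ^ n → x = 0)
    (hpow : ∀ (γ : ℂ) (n : ℕ), 0 < n → Q.charpoly.IsRoot γ → γ ^ n = ((α : ℂ)⁻¹) ^ n →
      γ = (α : ℂ)⁻¹)
    {γ : ℂ} (hγ : Q.charpoly.IsRoot γ) {n : ℕ} (hn : 0 < n) (h : γ ^ n = (α : ℂ) ^ n) :
    γ = α := by
  have hα0 : (α : ℂ) ≠ 0 := by exact_mod_cast hα.ne'
  have hγ0 : γ ≠ 0 := by
    rintro rfl
    rw [zero_pow hn.ne'] at h
    exact pow_ne_zero n hα0 h.symm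
  obtain ⟨x, hx0, hx⟩ := exists_mulVec_eq_smul_of_isRoot hγ
  have hΩx := hΩ x
  rw [hx, map_smul, Matrix.mulVec_smul] at hΩx
  have hroot : Q.transpose.charpoly.IsRoot γ⁻¹ :=
    isRoot_charpoly_of_mulVec_eq_smul (x := Ω x) (fun h0 => hx0 (hker x γ n hn hx h0 h)) (by
      nth_rw 2 [← hΩx]
      rw [smul_smul, inv_mul_cancel₀ hγ0, one_smul])
  rw [Matrix.charpoly_transpose] at hroot
  exact inv_injective (hpow γ⁻¹ n hn hroot (by rw [inv_pow, inv_pow, h]))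

end Multiplicity

/-! ### Passing to Galois conjugates -/

section Conjugates

open Polynomial

variable {p : ℚ[X]} {x β : ℂ}

lemma aeval_eq_zero_iff_of_isConjRoot (h : IsConjRoot ℚ x β) (q : ℚ[X]) :
    aeval x q = 0 ↔ aeval β q = 0 := by
  rw [← minpoly.dvd_iff, ← minpoly.dvd_iff, isConjRoot_def.1 h]

/-- Simplicity is expressed by rational polynomials, whose vanishing is the same at conjugate
points. -/
lemma rootMultiplicity_eq_one_iff (hp : p ≠ 0) (x : ℂ) :
    (p.map (algebraMap ℚ ℂ)).rootMultiplicity x = 1 ↔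
      aeval x p = 0 ∧ aeval x (derivative p) ≠ 0 := by
  have hp' : p.map (algebraMap ℚ ℂ) ≠ 0 := (Polynomial.map_ne_zero_iff (algebraMap ℚ ℂ).injective).2 hp
  have h1 := rootMultiplicity_pos hp' (x := x)
  have h2 := one_lt_rootMultiplicity_iff_isRoot hp' (t := x)
  rw [derivative_map, IsRoot.def, IsRoot.def, eval_map_algebraMap, eval_map_algebraMap] at h2
  rw [IsRoot.def, eval_map_algebraMap] at h1
  by_cases h3 : aeval x p = 0
  · by_cases h4 : aeval x (derivative p) = 0
    · simp only [h3, h4, and_self, iff_true] at h1 h2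
      simp [h4]; omega
    · simp only [h3, h4, and_false, iff_true, iff_false] at h1 h2
      simp [h3, h4]; omega
  · simp only [h3, iff_false] at h1
    simp [h3]; omega

lemma rootMultiplicity_eq_one_of_isConjRoot (hp : p ≠ 0) (h : IsConjRoot ℚ x β)
    (hx : (p.map (algebraMap ℚ ℂ)).rootMultiplicity x = 1) :
    (p.map (algebraMap ℚ ℂ)).rootMultiplicity β = 1 := by
  rw [rootMultiplicity_eq_one_iff hp] at hx ⊢
  rwa [← aeval_eq_zero_iff_of_isConjRoot h, Ne, ← aeval_eq_zero_iff_of_isConjRoot h]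

/-- If no other root of `p` has a power in common with `x`, then the arguments of the nonreal
conjugates of `x` are not rational multiples of `π`. -/
lemma div_norm_pow_ne_one_of_isConjRoot (hp : p ≠ 0) (h : IsConjRoot ℚ x β)
    (hx : aeval x p = 0)
    (hpow : ∀ (γ : ℂ) (n : ℕ), 0 < n → aeval γ p = 0 → γ ^ n = x ^ n → γ = x)
    (him : β.im ≠ 0) {n : ℕ} (hn : 0 < n) : (β / (‖β‖ : ℂ)) ^ n ≠ 1 := by
  intro hone
  have hβ : aeval β p = 0 := (aeval_eq_zero_iff_of_isConjRoot h p).1 hx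
  have hβ0 : β ≠ 0 := by rintro rfl; simp at him
  have hn0 : (‖β‖ : ℂ) ≠ 0 := by simpa using hβ0
  have hβn : β ^ n = (‖β‖ : ℂ) ^ n := by
    rw [div_pow, div_eq_one_iff_eq (pow_ne_zero n hn0)] at hone
    exact hone
  set β' := (starRingEnd ℂ) β with hβ'
  have hβ'n : β' ^ n = β ^ n := by
    rw [hβ', ← map_pow, hβn, map_pow, Complex.conj_ofReal]
  have hβ'p : aeval β' p = 0 := by
    have := congrArg (starRingEnd ℂ) hβ
    rw [map_zero, aeval_def, hom_eval₂] at this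
    rw [aeval_def, ← this]
    congr 1
    ext
    simp
  have hint : ∀ z ∈ ({β, β'} : Set ℂ),
      IsIntegral ℚ z ∧ ((minpoly ℚ z).map (algebraMap ℚ ℂ)).Splits := by
    intro z hz
    refine ⟨IsAlgebraic.isIntegral ⟨p, hp, ?_⟩, IsAlgClosed.splits _⟩
    rcases hz with rfl | rfl
    exacts [hβ, hβ'p]
  have hmem : ∀ z ∈ ({β, β'} : Set ℂ), z ∈ IntermediateField.adjoin ℚ ({β, β'} : Set ℂ) :=
    fun z hz => IntermediateField.subset_adjoin ℚ _ hz
  -- The embedding must be defined on both `β` and its complex conjugate, so that their common power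
  -- can be transported along with `β ↦ x`.
  obtain ⟨φ, hφ⟩ := IntermediateField.exists_algHom_adjoin_of_splits_of_aeval hint
    (hmem β (by simp)) h.symm.aeval_eq_zero
  set b : IntermediateField.adjoin ℚ ({β, β'} : Set ℂ) := ⟨β, hmem β (by simp)⟩
  set b' : IntermediateField.adjoin ℚ ({β, β'} : Set ℂ) := ⟨β', hmem β' (by simp)⟩
  have hb'p : aeval b' p = 0 := by
    have hι := (IntermediateField.adjoin ℚ ({β, β'} : Set ℂ)).val.toRingHom.injective
    apply hι
    rw [map_zero, aeval_def, hom_eval₂, ← hβ'p, aeval_def]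
    congr 1
  have hγ : φ b' = x := by
    refine hpow (φ b') n hn ?_ ?_
    · have := congrArg φ.toRingHom hb'p
      rw [map_zero, aeval_def, hom_eval₂] at this
      rw [aeval_def, ← this]
      congr 1
      exact Subsingleton.elim _ _
    · rw [← hφ, ← map_pow, ← map_pow]
      congr 1
      exact Subtype.ext hβ'n
  have hbb : b' = b := φ.injective (hγ.trans hφ.symm)
  have : β' = β := congrArg Subtype.val hbb
  exact him (Complex.conj_eq_iff_im.1 this)

end Conjugates

/-! ### Rauzy-Veech steps and the translation form -/

namespace IEM

variable {A : Type*} [Fintype A]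

section Orders

variable {K : Type*} [AddCommGroup K]

lemma prefixSum_comp_equiv (o o' : A ≃ Fin (Fintype.card A)) (e : Equiv.Perm A)
    (h : ∀ a, o' (e a) = o a) (v : A → K) (a : A) :
    prefixSum o' v (e a) = prefixSum o (fun b => v (e b)) a := by
  unfold prefixSum
  rw [← Equiv.sum_comp e]
  simp only [h]

variable [DecidableEq A] {o o' : A ≃ Fin (Fintype.card A)} {p q : A}

/-- The linear substitution `v p = v' p + v' q`, `v c = v' c` for `c ≠ p`. -/
def addAt (p q : A) (v : A → K) (c : A) : K := v c + if c = p then v q else 0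

lemma prefixSum_addAt_of_last (hp : (o p : ℕ) + 1 = Fintype.card A) (v : A → K) (c : A) :
    prefixSum o (addAt p q v) c = prefixSum o v c := by
  refine Finset.sum_congr rfl fun b _ => ?_
  have := (o c).isLt
  unfold addAt
  by_cases hb : b = p
  · subst hb
    have : ¬ o b < o c := by rw [Fin.lt_def]; omega
    rw [if_neg this, if_neg this]
  · rw [if_neg hb, add_zero]

lemma prefixSum_insertAfter_of_ne (hpq : p ≠ q) (hq : (o q : ℕ) + 1 = Fintype.card A)
    (ho : ∀ c, (o' c : ℕ) = insertAfter o p q c) (v : A → K) {c : A} (hc : c ≠ q) :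
    prefixSum o' v c = prefixSum o (addAt p q v) c := by
  have hinj : ∀ {a b : A}, a ≠ b → (o a : ℕ) ≠ o b := fun h h' => h (o.injective (Fin.ext h'))
  have hlt := (o c).isLt
  have h1 : ∀ b, (if o b < o c then addAt p q v b else 0) =
      (if o b < o c then v b else 0) + if b = p then (if o p < o c then v q else 0) else 0 := by
    intro b
    unfold addAt
    by_cases hb : b = p
    · subst hb; by_cases h : o b < o c <;> simp [h]
    · simp [hb]
  have h2 : ∀ b, (if o' b < o' c then v b else 0) =
      (if o b < o c then v b else 0) + if b = q then (if o p < o c then v q else 0) else 0 := by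
    intro b
    have hcq := hinj hc
    by_cases hb : b = q
    · subst hb
      have h3 : ¬ o b < o c := by rw [Fin.lt_def]; omega
      have h4 : o' b < o' c ↔ o p < o c := by
        rw [Fin.lt_def, Fin.lt_def, ho, ho]
        simp only [insertAfter, if_true, if_neg hc, Fin.le_def]
        split_ifs <;> omega
      simp [h3, h4]
    · have h4 : o' b < o' c ↔ o b < o c := by
        rw [Fin.lt_def, Fin.lt_def, ho, ho]
        simp only [insertAfter, if_neg hb, if_neg hc, Fin.le_def]
        split_ifs <;> omega
      simp [hb, h4]
  unfold prefixSum
  simp only [h1, h2, Finset.sum_add_distrib]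
  simp

lemma prefixSum_insertAfter_self (hpq : p ≠ q) (hq : (o q : ℕ) + 1 = Fintype.card A)
    (ho : ∀ c, (o' c : ℕ) = insertAfter o p q c) (v : A → K) :
    prefixSum o' v q = prefixSum o (addAt p q v) p + v p := by
  have hlt := (o p).isLt
  have h1 : ∀ b, (if o b < o p then addAt p q v b else 0) = if o b < o p then v b else 0 := by
    intro b
    unfold addAt
    by_cases hb : b = p
    · subst hb; simp
    · simp [hb]
  have h2 : ∀ b, (if o' b < o' q then v b else 0) =
      (if o b < o p then v b else 0) + if b = p then v p else 0 := by
    intro b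
    have hbp : b = p ↔ (o b : ℕ) = o p := by rw [Fin.val_inj, o.apply_eq_iff_eq]
    by_cases hb : b = q
    · subst hb
      have h3 : ¬ o b < o p := by rw [Fin.lt_def]; omega
      simp [h3, Ne.symm hpq]
    · by_cases hb' : b = p
      · subst hb'
        have h4 : o' b < o' q := by
          rw [Fin.lt_def, ho, ho]
          simp [insertAfter, hb]
        simp [h4]
      · rw [hbp] at hb'
        have h4 : o' b < o' q ↔ o b < o p := by
          rw [Fin.lt_def, Fin.lt_def, ho, ho]
          simp only [insertAfter, if_neg hb, if_true, Fin.le_def]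
          split_ifs <;> omega
        simp [h4, hbp, hb']
  unfold prefixSum
  simp only [h1, h2, Finset.sum_add_distrib]
  simp

variable {o₁ o₂ o₂' : A ≃ Fin (Fintype.card A)}

/-- The identity `Bᵗ Ω B = Ω'` in coordinates, with `p` the winner and `q` the loser. Only the moved
label `q` needs care; there the two orders are compared through their common total sum. -/
lemma prefixSum_sub_insertAfter (hpq : p ≠ q) (hp : (o₁ p : ℕ) + 1 = Fintype.card A)
    (hq : (o₂ q : ℕ) + 1 = Fintype.card A) (ho : ∀ c, (o₂' c : ℕ) = insertAfter o₂ p q c)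
    (v : A → K) (c : A) :
    prefixSum o₂' v c - prefixSum o₁ v c =
      (prefixSum o₂ (addAt p q v) c - prefixSum o₁ (addAt p q v) c) +
        if c = q then prefixSum o₂ (addAt p q v) p - prefixSum o₁ (addAt p q v) p else 0 := by
  rw [← prefixSum_addAt_of_last (q := q) hp v c]
  by_cases hc : c = q
  · subst hc
    have h1 := prefixSum_last o₁ (addAt p c v) hp
    have h2 := prefixSum_last o₂ (addAt p c v) hq
    rw [← h2] at h1
    have h3 : addAt p c v p = v p + v c := by simp [addAt]
    have h4 : addAt p c v c = v c := by simp [addAt, Ne.symm hpq]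
    rw [h3, h4] at h1
    rw [if_pos rfl, prefixSum_insertAfter_self hpq hq ho]
    have h5 : prefixSum o₂ (addAt p c v) c = prefixSum o₁ (addAt p c v) p + v p := by
      rw [← add_assoc] at h1
      exact (add_right_cancel h1).symm
    rw [h5]
    abel
  · rw [if_neg hc, add_zero, prefixSum_insertAfter_of_ne hpq hq ho v hc]

lemma prefixSum_eq_of_insertAfter (hpq : p ≠ q) (hp : (o₁ p : ℕ) + 1 = Fintype.card A)
    (hq : (o₂ q : ℕ) + 1 = Fintype.card A) (ho : ∀ c, (o₂' c : ℕ) = insertAfter o₂ p q c)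
    {v : A → K} (hv : ∀ c, prefixSum o₂' v c = prefixSum o₁ v c) (c : A) :
    prefixSum o₁ (addAt p q v) c = prefixSum o₁ v c ∧
      prefixSum o₂ (addAt p q v) c = prefixSum o₁ v c := by
  have h := fun c => prefixSum_sub_insertAfter hpq hp hq ho v c
  simp only [hv, sub_self] at h
  have hp0 := h p
  rw [if_neg hpq, add_zero] at hp0
  have hc0 := h c
  rw [← hp0, ite_self, add_zero] at hc0
  have h1 := prefixSum_addAt_of_last (q := q) hp v c
  exact ⟨h1, (sub_eq_zero.1 hc0.symm).trans h1⟩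

end Orders

/-- The translation vector as a linear function of the lengths. -/
noncomputable def omega (D : IEM A) : (A → ℂ) →ₗ[ℂ] (A → ℂ) where
  toFun v a := prefixSum D.bot v a - prefixSum D.top v a
  map_add' v w := by
    ext a
    simp only [prefixSum, Pi.add_apply, ← Finset.sum_add_distrib, ← Finset.sum_sub_distrib]
    refine Finset.sum_congr rfl fun b _ => ?_
    split_ifs <;> ring
  map_smul' c v := by
    ext a
    simp only [prefixSum, Pi.smul_apply, smul_eq_mul, Finset.mul_sum, ← Finset.sum_sub_distrib,
      RingHom.id_apply]
    refine Finset.sum_congr rfl fun b _ => ?_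
    split_ifs <;> ring

lemma omega_apply (D : IEM A) (v : A → ℂ) (a : A) :
    D.omega v a = prefixSum D.bot v a - prefixSum D.top v a := rfl

lemma omega_eq_zero_iff (D : IEM A) (v : A → ℂ) :
    D.omega v = 0 ↔ ∀ a, prefixSum D.bot v a = prefixSum D.top v a := by
  simp only [funext_iff, omega_apply, Pi.zero_apply, sub_eq_zero]

/-- `D'` is obtained from `D` by inducing with visit matrix `B`, which is compatible with the
translation forms and acts trivially on their kernels. -/
structure Refines [Nonempty A] (D D' : IEM A) (B : Matrix A A ℕ) : Prop where
  induces : Induces D.map D.label (Set.Ico 0 D'.total) D'.map D'.label B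
  total_le : D'.total ≤ D.total
  form : ∀ v : A → ℂ, (B.map ((↑) : ℕ → ℂ)).transpose.mulVec
    (D.omega ((B.map ((↑) : ℕ → ℂ)).mulVec v)) = D'.omega v
  ker : ∀ v : A → ℂ, D'.omega v = 0 → D.omega ((B.map ((↑) : ℕ → ℂ)).mulVec v) = 0 ∧
    ∀ a, prefixSum D.top ((B.map ((↑) : ℕ → ℂ)).mulVec v) a = prefixSum D'.top v a
  last_ne : ∀ a, (D.top a : ℕ) + 1 = Fintype.card A → (D.bot a : ℕ) + 1 ≠ Fintype.card A

lemma Refines.trans [Nonempty A] {D D' D'' : IEM A} {B B' : Matrix A A ℕ}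
    (h : Refines D D' B) (h' : Refines D' D'' B') : Refines D D'' (B * B') := by
  have hmap : (B * B').map ((↑) : ℕ → ℂ) = B.map ((↑) : ℕ → ℂ) * B'.map ((↑) : ℕ → ℂ) :=
    Matrix.map_mul (f := Nat.castRingHom ℂ)
  refine ⟨h.induces.comp h'.induces (Set.Ico_subset_Ico_right h'.total_le),
    h'.total_le.trans h.total_le, fun v => ?_, fun v hv => ?_, h.last_ne⟩
  · rw [hmap, ← Matrix.mulVec_mulVec, Matrix.transpose_mul, ← Matrix.mulVec_mulVec, h.form, h'.form]
  · obtain ⟨h1, h2⟩ := h'.ker v hv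
    obtain ⟨h3, h4⟩ := h.ker _ h1
    rw [hmap, ← Matrix.mulVec_mulVec]
    exact ⟨h3, fun a => (h4 a).trans (h2 a)⟩

section Step

variable [DecidableEq A]

/-- The elementary matrix `1 + e_{pq}`. -/
def elementary (p q : A) : Matrix A A ℕ := 1 + Matrix.single p q 1

lemma elementary_apply {A : Type*} [DecidableEq A] (p q a c : A) :
    elementary p q a c = (if a = c then 1 else 0) + if p = a ∧ q = c then 1 else 0 := by
  simp [elementary, Matrix.one_apply, Matrix.single_apply]

lemma elementary_mulVec (p q : A) (v : A → ℂ) :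
    ((elementary p q).map ((↑) : ℕ → ℂ)).mulVec v = addAt p q v := by
  ext c
  simp only [Matrix.mulVec, dotProduct, Matrix.map_apply, elementary_apply, addAt, Nat.cast_add,
    Nat.cast_ite, Nat.cast_one, Nat.cast_zero, add_mul, Finset.sum_add_distrib, ite_mul, one_mul,
    zero_mul, Finset.sum_ite_eq, Finset.mem_univ, if_true]
  congr 1
  by_cases hc : c = p
  · subst hc; simp
  · simp [hc, Ne.symm hc]

lemma elementary_transpose_mulVec (p q : A) (v : A → ℂ) (c : A) :
    ((elementary p q).map ((↑) : ℕ → ℂ)).transpose.mulVec v c =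
      v c + if c = q then v p else 0 := by
  simp only [Matrix.mulVec, dotProduct, Matrix.map_apply, Matrix.transpose_apply, elementary_apply,
    Nat.cast_add, Nat.cast_ite, Nat.cast_one, Nat.cast_zero, add_mul, Finset.sum_add_distrib,
    ite_mul, one_mul, zero_mul, Finset.sum_ite_eq', Finset.mem_univ, if_true]
  congr 1
  by_cases hc : c = q
  · subst hc; simp
  · simp [hc, Ne.symm hc]

lemma sum_mul_elementary (p q c : A) (g : A → ℕ) :
    ∑ a, g a * elementary p q a c = g c + if c = q then g p else 0 := by
  simp only [elementary_apply, mul_add, Finset.sum_add_distrib, mul_ite, mul_one, mul_zero,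
    Finset.sum_ite_eq', Finset.mem_univ, if_true]
  congr 1
  by_cases hc : c = q
  · subst hc; simp
  · simp [hc, Ne.symm hc]

/-- Only the loser `q` takes two steps to return, passing once through `p` and once through `q`. The
order of these two visits depends on which side wins. -/
lemma induces_elementary [Nonempty A] {D D' : IEM A} {p q : A}
    (hne : ∀ c ≠ q, ∀ t ∈ D'.interval c, t ∈ D.interval c ∧ D.delta c = D'.delta c)
    (hq : ∀ t ∈ D'.interval q, ∃ x y, t ∈ D.interval x ∧ t + D.delta x ∈ D.interval y ∧
      D'.total ≤ t + D.delta x ∧ D.delta x + D.delta y = D'.delta q ∧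
        (x = p ∧ y = q ∨ x = q ∧ y = p)) :
    Induces D.map D.label (Set.Ico 0 D'.total) D'.map D'.label (elementary p q) := by
  intro t ht
  have htc := mem_interval_label ht
  have hT' := map_mem ht
  have hDt' := map_of_mem htc
  by_cases hc : D'.label t = q
  · rw [hc] at htc
    obtain ⟨x, y, hx, hy, htot, hδ, hxy⟩ := hq t htc
    have h1 : D.map t = t + D.delta x := map_of_mem hx
    have h2 : D.map^[2] t = D'.map t := by
      change D.map (D.map t) = _
      rw [h1, map_of_mem hy, hDt', hc, ← hδ, add_assoc]
    refine ⟨2, ⟨two_pos, h2 ▸ hT', fun k hk hk2 => ?_⟩, h2, fun g => ?_⟩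
    · obtain rfl : k = 1 := by omega
      rw [Function.iterate_one, h1]
      intro h
      linarith [h.2]
    · rw [sum_mul_elementary, hc, if_pos rfl, Finset.sum_range_succ, Finset.sum_range_one,
        Function.iterate_zero, id, Function.iterate_one, h1, label_eq hx, label_eq hy]
      rcases hxy with ⟨rfl, rfl⟩ | ⟨rfl, rfl⟩
      · rw [add_comm]
      · rfl
  · obtain ⟨h1, h2⟩ := hne _ hc t htc
    have h3 : D.map t = D'.map t := by rw [hDt', map_of_mem h1, h2]
    refine ⟨1, ⟨one_pos, ?_, by omega⟩, h3, fun g => ?_⟩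
    · rw [Function.iterate_one, h3]; exact hT'
    · rw [sum_mul_elementary, if_neg hc, Finset.sum_range_one, Function.iterate_zero, id,
        label_eq h1, add_zero]

lemma RauzyVeechStep.exists_refines [Nonempty A] {D D' : IEM A} (h : RauzyVeechStep D D') :
    ∃ B, Refines D D' B := by
  obtain ⟨a, b, ha, hb, h⟩ := h
  have hab : a ≠ b := by
    rintro rfl
    rcases h with h | h <;> exact lt_irrefl _ h.1
  have hlast : ∀ c, (D.top c : ℕ) + 1 = Fintype.card A → (D.bot c : ℕ) + 1 ≠ Fintype.card A := by
    intro c hc hc'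
    have h1 : c = a := D.top.injective (Fin.ext (by omega))
    have h2 : c = b := D.bot.injective (Fin.ext (by omega))
    exact hab (h1.symm.trans h2)
  have hlen : ∀ {p q : A}, p ≠ q → D'.len = Function.update D.len p (D.len p - D.len q) →
      D.len = addAt p q D'.len ∧ D'.len p = D.len p - D.len q ∧ D'.len q = D.len q ∧
        D'.total = D.total - D.len q ∧ ∀ c, D'.len c ≤ D.len c := by
    intro p q hpq hl
    have hp' : D'.len p = D.len p - D.len q := by rw [hl, Function.update_self]
    have hq' : D'.len q = D.len q := by rw [hl, Function.update_of_ne hpq.symm]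
    have h1 : D.len = addAt p q D'.len := by
      ext c
      unfold addAt
      by_cases hc : c = p
      · subst hc; rw [if_pos rfl, hp', hq']; ring
      · rw [if_neg hc, hl, Function.update_of_ne hc, add_zero]
    have h2 : D.total = D'.total + D.len q := by
      rw [← hq', total, h1, total]
      simp [addAt, Finset.sum_add_distrib]
    refine ⟨h1, hp', hq', by linarith, fun c => ?_⟩
    rw [h1]
    unfold addAt
    split_ifs
    · linarith [D'.len_pos q]
    · linarith
  have htop : D.left a + D.len a = D.total := prefixSum_last D.top D.len ha
  have hbot : D.leftImage b + D.len b = D.total := prefixSum_last D.bot D.len hb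
  rcases h with ⟨hlt, hl, ht', hb'⟩ | ⟨hlt, hl, hb', ht'⟩
  · obtain ⟨hadd, hpa, hqb, htot, hle⟩ := hlen hab hl
    have hleft : ∀ c, D'.left c = D.left c := fun c => by
      rw [left_eq_prefixSum, left_eq_prefixSum, hadd, prefixSum_addAt_of_last ha, ht']
    have himg : ∀ c ≠ b, D'.leftImage c = D.leftImage c := fun c hc => by
      rw [leftImage_eq_prefixSum, leftImage_eq_prefixSum, hadd,
        prefixSum_insertAfter_of_ne hab hb hb' _ hc]
    have himgb : D'.leftImage b = D.leftImage a + D'.len a := by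
      rw [leftImage_eq_prefixSum, leftImage_eq_prefixSum, hadd,
        prefixSum_insertAfter_self hab hb hb']
    refine ⟨elementary a b, ?_, by linarith [D.len_pos b], fun v => ?_, fun v hv => ?_, hlast⟩
    · refine induces_elementary (fun c hc t ht => ?_) fun t ht => ?_
      · rw [mem_interval, hleft] at ht
        exact ⟨⟨ht.1, by linarith [hle c, ht.2]⟩, by rw [delta, delta, hleft, himg c hc]⟩
      · rw [mem_interval, hleft, hqb] at ht
        refine ⟨b, a, ⟨ht.1, ht.2⟩, ?_, ?_, ?_, Or.inr ⟨rfl, rfl⟩⟩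
        · rw [mem_interval, delta]; constructor <;> linarith [ht.1, ht.2]
        · rw [delta]; linarith [ht.1]
        · rw [delta, delta, delta, hleft, himgb]; linarith
    · ext c
      rw [elementary_mulVec, elementary_transpose_mulVec, omega_apply, omega_apply, omega_apply, ht',
        prefixSum_sub_insertAfter hab ha hb hb']
    · rw [omega_eq_zero_iff] at hv
      rw [ht'] at hv
      have := prefixSum_eq_of_insertAfter hab ha hb hb' hv
      rw [elementary_mulVec, omega_eq_zero_iff, ht']
      exact ⟨fun c => (this c).2.trans (this c).1.symm, fun c => (this c).1⟩
  · obtain ⟨hadd, hpb, hqa, htot, hle⟩ := hlen hab.symm hl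
    have himg : ∀ c, D'.leftImage c = D.leftImage c := fun c => by
      rw [leftImage_eq_prefixSum, leftImage_eq_prefixSum, hadd, prefixSum_addAt_of_last hb, hb']
    have hleft : ∀ c ≠ a, D'.left c = D.left c := fun c hc => by
      rw [left_eq_prefixSum, left_eq_prefixSum, hadd,
        prefixSum_insertAfter_of_ne hab.symm ha ht' _ hc]
    have hlefta : D'.left a = D.left b + D'.len b := by
      rw [left_eq_prefixSum, left_eq_prefixSum, hadd,
        prefixSum_insertAfter_self hab.symm ha ht']
    refine ⟨elementary b a, ?_, by linarith [D.len_pos a], fun v => ?_, fun v hv => ?_, hlast⟩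
    · refine induces_elementary (fun c hc t ht => ?_) fun t ht => ?_
      · rw [mem_interval, hleft c hc] at ht
        exact ⟨⟨ht.1, by linarith [hle c, ht.2]⟩, by rw [delta, delta, hleft c hc, himg c]⟩
      · rw [mem_interval, hlefta, hqa] at ht
        have hbtot : D.leftImage b + D.len b = D.total := hbot
        have hpos := D'.len_pos b
        refine ⟨b, a, ⟨by linarith, by linarith⟩, ?_, ?_, ?_, Or.inl ⟨rfl, rfl⟩⟩
        · rw [mem_interval, delta]; constructor <;> linarith [ht.1, ht.2]
        · rw [delta]; linarith [ht.1]
        · rw [delta, delta, delta, hlefta, himg]; linarith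
    · ext c
      have := prefixSum_sub_insertAfter hab.symm hb ha ht' v c
      rw [elementary_mulVec, elementary_transpose_mulVec, omega_apply, omega_apply, omega_apply, hb']
      -- When the last label after the exchange wins, the two orders trade roles, which changes the
      -- sign of the form.
      rw [← neg_inj, neg_sub, this, neg_add, neg_sub]
      split_ifs <;> ring
    · rw [omega_eq_zero_iff] at hv
      rw [hb'] at hv
      have := prefixSum_eq_of_insertAfter hab.symm hb ha ht' fun c => (hv c).symm
      rw [elementary_mulVec, omega_eq_zero_iff]
      exact ⟨fun c => (this c).1.trans (this c).2.symm, fun c => (this c).2.trans (hv c)⟩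

lemma exists_refines_of_transGen [Nonempty A] {D D' : IEM A}
    (h : Relation.TransGen RauzyVeechStep D D') : ∃ B, Refines D D' B := by
  induction h with
  | single h => exact h.exists_refines
  | tail _ h ih =>
    obtain ⟨B, hB⟩ := ih
    obtain ⟨B', hB'⟩ := RauzyVeechStep.exists_refines h
    exact ⟨_, hB.trans hB'⟩

end Step

end IEM

/-! ### The renormalization matrix under periodicity, and the conclusion -/

namespace IEM

variable {A : Type*} [Fintype A] [DecidableEq A] {D : IEM A} {α : ℝ} {r : A → ℕ}

lemma substMatrix_eq_transpose {A : Type*} [Fintype A] (D : IEM A) (α : ℝ) (r : A → ℕ) :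
    D.substMatrix α r = ((D.renormMatrix α r).map ((↑) : ℕ → ℂ)).transpose := rfl

lemma charpoly_substMatrix (D : IEM A) (α : ℝ) (r : A → ℕ) :
    (D.substMatrix α r).charpoly = ((D.renormMatrix α r).map ((↑) : ℕ → ℂ)).charpoly := by
  rw [substMatrix_eq_transpose, Matrix.charpoly_transpose]

lemma charpoly_substMatrix_eq_map (D : IEM A) (α : ℝ) (r : A → ℕ) :
    (D.substMatrix α r).charpoly =
      ((D.renormMatrix α r).map ((↑) : ℕ → ℚ)).charpoly.map (algebraMap ℚ ℂ) := by
  rw [charpoly_substMatrix, ← Matrix.charpoly_map]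
  congr 1

/-- If the map is the identity, all nonzero eigenvalues are roots of unity. -/
lemma eq_one_of_isRoot_of_map_eq_self [Nonempty A] (hD : D.IsSelfSimilar α)
    (hr : D.HasReturnTimes α r) (hid : ∀ x ∈ Set.Ico 0 D.total, D.map x = x) {x : ℝ} (hx : 0 < x)
    (hroot : (D.substMatrix α r).charpoly.IsRoot (x : ℂ)) : x = 1 := by
  obtain ⟨v, hv0, hv⟩ := exists_mulVec_eq_smul_of_isRoot hroot
  -- Under the identity all return times are one, so each column of the matrix has a single nonzero
  -- entry, equal to `1`.
  have hR : ∀ a b, D.renormMatrix α r a b = if D.label (α * D.left b) = a then 1 else 0 := by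
    intro a b
    have hb := mem_Ico_of_mem_interval (left_mem_interval (D := D) b)
    have ht : α * D.left b ∈ Set.Ico 0 α := by simpa using hD.mul_mem hb 1
    have hfix := hid _ (by simpa using hD.Ico_pow_subset 1 (by simpa using ht))
    obtain ⟨n, hn, -, hg⟩ := induces_rescaledMap hD hr _ ht
    have hn1 : n = 1 := hn.unique ⟨one_pos, by simpa [hfix] using ht, by omega⟩
    subst hn1
    have := hg fun c => if c = a then 1 else 0
    rw [rescaledLabel, inv_mul_cancel_left₀ hD.pos.ne', label_eq (left_mem_interval b)] at this
    rw [Finset.sum_range_one, Function.iterate_zero, id] at this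
    simpa using this.symm
  set f : A → A := fun b => D.label (α * D.left b) with hf
  have hvf : ∀ b, v (f b) = x * v b := by
    intro b
    have := congrFun hv b
    rw [substMatrix_eq_transpose] at this
    simpa [Matrix.mulVec, dotProduct, hR] using this
  have hiter : ∀ n b, v (f^[n] b) = (x : ℂ) ^ n * v b := by
    intro n b
    induction n with
    | zero => simp
    | succ n ih => rw [Function.iterate_succ_apply', hvf, ih, pow_succ]; ring
  obtain ⟨b, hb⟩ := Function.ne_iff.1 hv0
  obtain ⟨i, j, hij, h⟩ := Finite.exists_ne_map_eq_of_infinite fun n => f^[n] b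
  have h' : (x : ℂ) ^ i = (x : ℂ) ^ j := by
    have := congrArg v h
    rw [hiter, hiter] at this
    exact mul_right_cancel₀ hb this
  by_contra hne
  exact hij (pow_right_injective₀ hx hne (by exact_mod_cast h'))

/-- For a Rauzy-Veech periodic map, the renormalization matrix preserves the translation form,
and on the kernel of that form its eigenvalues are roots of unity. -/
lemma IsRauzyVeechPeriodic.form_and_ker [Nonempty A] (hD : D.IsSelfSimilar α)
    (hr : D.HasReturnTimes α r) (h : D.IsRauzyVeechPeriodic α) :
    (∀ v : A → ℂ, ((D.renormMatrix α r).map ((↑) : ℕ → ℂ)).transpose.mulVec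
      (D.omega (((D.renormMatrix α r).map ((↑) : ℕ → ℂ)).mulVec v)) = D.omega v) ∧
    ∀ (x : A → ℂ) (γ : ℂ) (n : ℕ), 0 < n →
      ((D.renormMatrix α r).map ((↑) : ℕ → ℂ)).mulVec x = γ • x → D.omega x = 0 →
        γ ^ n = (α : ℂ) ^ n → x = 0 := by
  obtain ⟨D', hD', e, he⟩ := h
  obtain ⟨B, hB⟩ := exists_refines_of_transGen hD'
  have hα := hD.pos
  have htot : D'.total = α := by
    rw [total, ← Equiv.sum_comp e]
    simp only [(he _).1]
    rw [← Finset.mul_sum, hD.sum_len, mul_one]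
  have hleft : ∀ a, D'.left (e a) = α * D.left a := by
    intro a
    rw [left_eq_prefixSum, prefixSum_comp_equiv D.top D'.top e (fun a => (he a).2.1),
      left_eq_prefixSum]
    simp only [(he _).1, prefixSum, Finset.mul_sum, mul_ite, mul_zero]
  -- Both matrices count visits before the first return to the same interval, evaluated at a left
  -- endpoint; only the names of the columns differ.
  have hRB : ∀ a b, D.renormMatrix α r a b = B a (e b) := by
    intro a b
    have hb := mem_Ico_of_mem_interval (left_mem_interval (D := D) b)
    have ht : α * D.left b ∈ Set.Ico 0 α := by simpa using hD.mul_mem hb 1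
    obtain ⟨n, hn, -, hg⟩ := induces_rescaledMap hD hr _ ht
    have hlab : D'.label (α * D.left b) = e b := label_eq (hleft b ▸ left_mem_interval (e b))
    have hBi := hB.induces
    rw [htot] at hBi
    obtain ⟨m, hm, -, hg'⟩ := hBi _ ht
    obtain rfl := hn.unique hm
    have h1 := hg fun c => if c = a then 1 else 0
    have h2 := hg' fun c => if c = a then 1 else 0
    rw [h1, rescaledLabel, inv_mul_cancel_left₀ hα.ne', label_eq (left_mem_interval b), hlab] at h2
    simpa using h2
  set Q := (D.renormMatrix α r).map ((↑) : ℕ → ℂ) with hQ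
  have hQv : ∀ v : A → ℂ, Q.mulVec v = (B.map ((↑) : ℕ → ℂ)).mulVec fun c => v (e.symm c) := by
    intro v
    ext a
    simp only [Matrix.mulVec, dotProduct, hQ, Matrix.map_apply, hRB]
    rw [← Equiv.sum_comp e fun c => (B a c : ℂ) * v (e.symm c)]
    simp only [Equiv.symm_apply_apply]
  have hprefix : ∀ (v : A → ℂ) a, prefixSum D'.top (fun c => v (e.symm c)) (e a) =
      prefixSum D.top v a := by
    intro v a
    rw [prefixSum_comp_equiv D.top D'.top e fun a => (he a).2.1]
    simp only [Equiv.symm_apply_apply]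
  have homega : ∀ (v : A → ℂ) a, D'.omega (fun c => v (e.symm c)) (e a) = D.omega v a := by
    intro v a
    rw [omega_apply, omega_apply, hprefix, prefixSum_comp_equiv D.bot D'.bot e fun a => (he a).2.2]
    simp only [Equiv.symm_apply_apply]
  refine ⟨fun v => ?_, fun x γ n hn hx hΩ hγ => ?_⟩
  · ext b
    rw [← homega, ← hB.form, hQv]
    simp only [Matrix.mulVec, dotProduct, hQ, Matrix.map_apply, Matrix.transpose_apply, hRB]
  · have hΩ' : D'.omega (fun c => x (e.symm c)) = 0 := by
      ext c
      rw [← e.apply_symm_apply c, homega, hΩ]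
      rfl
    have hker := (hB.ker _ hΩ').2
    rw [← hQv, hx] at hker
    set u := prefixSum D.top x with hu
    have hstep : ∀ a, u a = γ * u (e a) := by
      intro a
      rw [hu, ← hprefix, ← hker]
      simp only [prefixSum, Pi.smul_apply, smul_eq_mul, Finset.mul_sum, mul_ite, mul_zero]
    have hpow : ∀ (k : ℕ) a, u a = γ ^ k * u ((e ^ k) a) := by
      intro k
      induction k with
      | zero => simp
      | succ k ih =>
        intro a
        rw [ih a, hstep, pow_succ' e, Equiv.Perm.mul_apply, pow_succ]
        ring
    -- A nonzero prefix sum would give `γ ^ orderOf e = 1`, hence a positive power of `α` equal to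
    -- `1`.
    have hu0 : ∀ a, u a = 0 := by
      intro a
      by_contra ha
      have h1 := hpow (orderOf e) a
      rw [pow_orderOf_eq_one, Equiv.Perm.one_apply] at h1
      have h2 : γ ^ orderOf e = 1 := mul_right_cancel₀ ha (h1.symm.trans (one_mul _).symm)
      have h3 : (α : ℂ) ^ (n * orderOf e) = 1 := by
        rw [pow_mul, ← hγ, ← pow_mul, mul_comm, pow_mul, h2, one_pow]
      have h4 : α ^ (n * orderOf e) = 1 := by exact_mod_cast h3
      have h5 := pow_lt_one₀ hα.le hD.lt_one (Nat.mul_pos hn (orderOf_pos e)).ne'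
      linarith
    have hvanish : ∀ (o : A ≃ Fin (Fintype.card A)), (∀ a, prefixSum o x a = 0) → ∀ a,
        (o a : ℕ) + 1 ≠ Fintype.card A → x a = 0 := by
      intro o ho a ha
      have hlt := (o a).isLt
      have := prefixSum_succ o x (a := a) (b := o.symm ⟨(o a : ℕ) + 1, by omega⟩) (by simp)
      rw [ho, ho, zero_add] at this
      exact this.symm
    ext a
    -- Vanishing prefix sums in one order leave only the coordinate of its last label undetermined;
    -- the last labels of the two orders differ because a Rauzy-Veech step is defined.
    by_cases ha : (D.top a : ℕ) + 1 = Fintype.card A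
    · refine hvanish D.bot (fun c => ?_) a (hB.last_ne a ha)
      rw [(omega_eq_zero_iff D x).1 hΩ c]
      exact hu0 c
    · exact hvanish D.top hu0 a ha

/-- `α⁻¹` is a simple root of the characteristic polynomial, and no other root has a power in
common with it. -/
lemma simple_inv_of_aperiodic [Nonempty A] (hD : D.IsSelfSimilar α) (hr : D.HasReturnTimes α r)
    (hap : D.Aperiodic) :
    ((D.renormMatrix α r).map ((↑) : ℕ → ℂ)).charpoly.rootMultiplicity (α : ℂ)⁻¹ = 1 ∧
      ∀ (γ : ℂ) (n : ℕ), 0 < n → ((D.renormMatrix α r).map ((↑) : ℕ → ℂ)).charpoly.IsRoot γ →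
        γ ^ n = ((α : ℂ)⁻¹) ^ n → γ = (α : ℂ)⁻¹ := by
  obtain ⟨N, hN⟩ := exists_renormMatrix_pow_pos hD hr hap
  have hR : ((D.renormMatrix α r).map ((↑) : ℕ → ℝ)).mulVec D.len = α⁻¹ • D.len := by
    ext a
    simpa [Matrix.mulVec, dotProduct] using sum_renormMatrix_mul_len hD hr hap a
  have hρ := inv_pos.2 hD.pos
  rw [← Complex.ofReal_inv]
  exact ⟨rootMultiplicity_eq_one_of_primitive hN D.len_pos hρ hR,
    fun γ n hn hγ h => eq_of_pow_eq_of_primitive hN D.len_pos hρ hR hγ hn h⟩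

/-- The conclusion follows for all conjugates of a simple root `x` which shares no power with
another root. -/
lemma simple_of_isConjRoot {x β : ℂ} (hconj : IsConjRoot ℚ x β)
    (hmult : (D.substMatrix α r).charpoly.rootMultiplicity x = 1)
    (hpow : ∀ (γ : ℂ) (n : ℕ), 0 < n → (D.substMatrix α r).charpoly.IsRoot γ →
      γ ^ n = x ^ n → γ = x) :
    (D.substMatrix α r).charpoly.rootMultiplicity β = 1 ∧
      Module.finrank ℂ (Module.End.eigenspace (Matrix.toLin' (D.substMatrix α r)) β) = 1 ∧
      (β.im ≠ 0 → ∀ n : ℕ, 0 < n → (β / (‖β‖ : ℂ)) ^ n ≠ 1) := by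
  set p := ((D.renormMatrix α r).map ((↑) : ℕ → ℚ)).charpoly with hp
  have hp0 : p ≠ 0 := (Matrix.charpoly_monic _).ne_zero
  have hpM := charpoly_substMatrix_eq_map D α r
  rw [← hp] at hpM
  have hβ : (D.substMatrix α r).charpoly.rootMultiplicity β = 1 := by
    rw [hpM] at hmult ⊢
    exact rootMultiplicity_eq_one_of_isConjRoot hp0 hconj hmult
  refine ⟨hβ, finrank_eigenspace_eq_one hβ, fun him n hn => ?_⟩
  rw [hpM] at hmult
  refine div_norm_pow_ne_one_of_isConjRoot hp0 hconj ((rootMultiplicity_eq_one_iff hp0 x).1 hmult).1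
    (fun γ n hn hγ h => hpow γ n hn ?_ h) him hn
  rw [hpM, Polynomial.IsRoot.def, Polynomial.eval_map_algebraMap]
  exact hγ

lemma isRoot_of_isConjRoot {x β : ℂ} (hconj : IsConjRoot ℚ x β)
    (hβ : (D.substMatrix α r).charpoly.IsRoot β) : (D.substMatrix α r).charpoly.IsRoot x := by
  rw [charpoly_substMatrix_eq_map, Polynomial.IsRoot.def, Polynomial.eval_map_algebraMap] at hβ ⊢
  exact (aeval_eq_zero_iff_of_isConjRoot hconj _).2 hβ

lemma aperiodic_of_isRoot [Nonempty A] (hD : D.IsSelfSimilar α) (hr : D.HasReturnTimes α r) {x : ℝ}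
    (hx : 0 < x) (hx1 : x ≠ 1) (hroot : (D.substMatrix α r).charpoly.IsRoot (x : ℂ)) :
    D.Aperiodic := by
  refine aperiodic_of_delta_ne_zero hD hr fun h0 => hx1 ?_
  exact eq_one_of_isRoot_of_map_eq_self hD hr
    (fun y hy => map_eq_self_of_delta_eq_zero hD hr h0 hy) hx hroot

end IEM

theorem mainTheorem5 {A : Type*} [Fintype A] [DecidableEq A] (D : IEM A) (α : ℝ) (r : A → ℕ)
    (hD : D.IsSelfSimilar α) (hr : D.HasReturnTimes α r) (β : ℂ)
    (hβ : Module.End.HasEigenvalue (Matrix.toLin' (D.substMatrix α r)) β)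
    (hconj : IsConjRoot ℚ ((α : ℂ)⁻¹) β ∨
      (IsConjRoot ℚ (α : ℂ) β ∧ D.IsRauzyVeechPeriodic α)) :
    (D.substMatrix α r).charpoly.rootMultiplicity β = 1 ∧
      Module.finrank ℂ (Module.End.eigenspace (Matrix.toLin' (D.substMatrix α r)) β) = 1 ∧
      (β.im ≠ 0 → ∀ n : ℕ, 0 < n → (β / (‖β‖ : ℂ)) ^ n ≠ 1) := by
  have := hD.nonempty
  have hα := hD.pos
  rw [Module.End.hasEigenvalue_iff_isRoot_charpoly, Matrix.charpoly_toLin'] at hβ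
  rcases hconj with hconj | ⟨hconj, hper⟩
  · have hroot := IEM.isRoot_of_isConjRoot hconj hβ
    rw [← Complex.ofReal_inv] at hroot
    have hap := IEM.aperiodic_of_isRoot hD hr (inv_pos.2 hα) (by
      rw [Ne, inv_eq_one]
      exact hD.lt_one.ne) hroot
    have hsimple := IEM.simple_inv_of_aperiodic hD hr hap
    rw [← IEM.charpoly_substMatrix] at hsimple
    exact IEM.simple_of_isConjRoot hconj hsimple.1 hsimple.2
  · have hroot := IEM.isRoot_of_isConjRoot hconj hβ
    have hap := IEM.aperiodic_of_isRoot hD hr hα hD.lt_one.ne hroot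
    have hsimple := IEM.simple_inv_of_aperiodic hD hr hap
    obtain ⟨hform, hker⟩ := hper.form_and_ker hD hr
    rw [IEM.charpoly_substMatrix] at hroot
    refine IEM.simple_of_isConjRoot hconj ?_ ?_
    · rw [IEM.charpoly_substMatrix]
      exact rootMultiplicity_eq_one_of_form hα D.omega hform hker hsimple.1 hroot
    · rw [IEM.charpoly_substMatrix]
      exact fun γ n hn hγ h => eq_of_pow_eq_of_form hα D.omega hform hker hsimple.2 hγ hn h
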